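/- For a C*-algebra $E$ write $E_+$ for its positive elements and $E_+^1=\{x\in E_+ : \|x\|\le 1\}$; for $x,y\in E_+$ write $x\precsim_E y$ (Cuntz subequivalence) if there is a sequence $(z_k)$ in $E$ with $\|x-z_k^*yz_k\|\to 0$. Let $A$ be an infinite-dimensional simple unital C*-algebra, let $G$ be a finite group with $n=|G|$, and let $\alpha\colon G\to \mathrm{Aut}(A)$ be an action with the weak tracial Rokhlin property. That is, for every finite set $F\subset A$, every $\varepsilon>0$ and every $s\in A_+$ with $\|s\|=1$, there are elements $f_g\in A_+^1$ ($g\in G$) with $f_gf_h=0$ for $g\neq h$ such that, with $f=\sum_{g\in G}f_g$: $\|f_gx-xf_g\|<\varepsilon$ for all $x\in F$ and $g\in G$; $\|\alpha_g(f_h)-f_{gh}\|<\varepsilon$ for all $g,h\in G$; $1-f\precsim_A s$; and $\|fsf\|>1-\varepsilon$. Then for every finite set $F\subset A\rtimes_\alpha G$, every $\varepsilon>0$ and every nonzero positive $s\in A\rtimes_\alpha G$, there exist an element $a\in A_+^1$, a C*-subalgebra $B$ of $A\rtimes_\alpha G$ that is $*$-isomorphic to $\overline{aAa}\otimes M_n$,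 and an element $d\in B_+^1$, such that 1. $\|dx-xd\|<\varepsilon$ for all $x\in F$; 2. for every $x\in F$ there is $b\in B$ with $\|dx-b\|<\varepsilon$; 3. $1-d\precsim_{A\rtimes_\alpha G}s$; 4. $\|dxd\|>\|x\|-\varepsilon$ for all $x\in F$. -/

import Mathlib

/-- A C*-algebra is simple if it is nonzero and has no closed two-sided ideals besides `0` and
the whole algebra. -/
def IsSimpleCStar (A : Type*) [NonUnitalCStarAlgebra A] : Prop :=
  Nontrivial A ∧ ∀ I : TwoSidedIdeal A, IsClosed (I : Set A) → I = ⊥ ∨ I = ⊤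

/-- Cuntz subequivalence `a ≾ b` in the C*-algebra `E`, for (positive) elements `a`, `b` of `E`:
there is a sequence `x` in `E` with `‖a - xₖ* b xₖ‖ → 0`. -/
def CuntzLE {E : Type*} [NonUnitalCStarAlgebra E] (a b : E) : Prop :=
  ∃ x : ℕ → E,
    Filter.Tendsto (fun k => ‖a - star (x k) * b * x k‖) Filter.atTop (nhds (0 : ℝ))

/-- The weak tracial Rokhlin property of an action `α` of a finite group `G` on a unital
C*-algebra `A`. -/
def WeakTracialRokhlin {A G : Type*} [CStarAlgebra A] [PartialOrder A] [StarOrderedRing A]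
    [Group G] [Fintype G] (α : G →* (A ≃⋆ₐ[ℂ] A)) : Prop :=
  ∀ (F : Finset A) (ε : ℝ), 0 < ε → ∀ s : A, 0 ≤ s → ‖s‖ = 1 →
    ∃ f : G → A,
      (∀ g, 0 ≤ f g ∧ ‖f g‖ ≤ 1) ∧
      (∀ g h, g ≠ h → f g * f h = 0) ∧
      (∀ x ∈ F, ∀ g, ‖f g * x - x * f g‖ < ε) ∧
      (∀ g h, ‖α g (f h) - f (g * h)‖ < ε) ∧
      CuntzLE (1 - ∑ g, f g) s ∧
      1 - ε < ‖(∑ g, f g) * s * (∑ g, f g)‖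

/-- The closure of `aAa` for a self-adjoint element `a` of a C*-algebra `A`, as a
C*-subalgebra of `A`. -/
def hereditarySubalgebra {A : Type*} [NonUnitalCStarAlgebra A] (a : A) (ha : IsSelfAdjoint a) :
    NonUnitalStarSubalgebra ℂ A :=
  NonUnitalStarSubalgebra.topologicalClosure
    { carrier := Set.range fun x : A => a * x * a
      add_mem' := by
        rintro _ _ ⟨x, rfl⟩ ⟨y, rfl⟩
        exact ⟨x + y, by simp only [mul_add, add_mul]⟩
      zero_mem' := ⟨0, by simp⟩
      mul_mem' := by
        rintro _ _ ⟨x, rfl⟩ ⟨y, rfl⟩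
        exact ⟨x * a * a * y, by simp only [mul_assoc]⟩
      smul_mem' := by
        rintro c _ ⟨x, rfl⟩
        exact ⟨c • x, by simp only [mul_smul_comm, smul_mul_assoc]⟩
      star_mem' := by
        rintro _ ⟨x, rfl⟩
        exact ⟨star x, by simp only [star_mul, ha.star_eq, mul_assoc]⟩ }

section CrossedProduct

variable {A G : Type*} [CStarAlgebra A] [PartialOrder A] [StarOrderedRing A]
  [Group G] [Fintype G] [DecidableEq G]

/-- The regular representation of `A` on the Hilbert module `ℓ²(G, A)`, whose adjointable
operators are the `G × G` matrices over `A`: `π(a)` is the diagonal matrix with entries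
`α_{h⁻¹}(a)`. -/
def regularRep (α : G →* (A ≃⋆ₐ[ℂ] A)) (a : A) : CStarMatrix G G A :=
  CStarMatrix.ofMatrix (Matrix.diagonal fun h => α h⁻¹ a)

/-- The left translation unitary `u_g` on `ℓ²(G, A)`, sending the basis vector `δ_k` to `δ_{gk}`.
Together with `regularRep` it satisfies `u_g π(a) u_g* = π(α_g(a))`. -/
def translationUnitary (A : Type*) {G : Type*} [CStarAlgebra A] [Group G] [DecidableEq G]
    (g : G) : CStarMatrix G G A :=
  CStarMatrix.ofMatrix (Matrix.of fun h k => if h = g * k then 1 else 0)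

/-- The C*-algebra generated by the regular covariant representation `(π, u)` of `(G, A, α)`. -/
noncomputable def regularCrossedProduct (α : G →* (A ≃⋆ₐ[ℂ] A)) :
    StarSubalgebra ℂ (CStarMatrix G G A) :=
  (StarAlgebra.adjoin ℂ
    (Set.range (regularRep α) ∪ Set.range (translationUnitary A (G := G)))).topologicalClosure

/-- The crossed product `A ⋊_α G` of a unital C*-algebra by a finite group. As `G` is finite, the
full and the reduced crossed product coincide, and both are the C*-algebra generated by the
regular covariant representation. -/
def CrossedProduct (α : G →* (A ≃⋆ₐ[ℂ] A)) : Type _ :=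
  regularCrossedProduct α

noncomputable instance CrossedProduct.instCStarAlgebra (α : G →* (A ≃⋆ₐ[ℂ] A)) :
    CStarAlgebra (CrossedProduct α) :=
  StarSubalgebra.cstarAlgebra (regularCrossedProduct α)
    (h_closed := StarSubalgebra.isClosed_topologicalClosure _)

/-- The usual order of a C*-algebra: `0 ≤ x` if `x` is self-adjoint with nonnegative spectrum,
equivalently `x = y* y` for some `y`. -/
noncomputable instance CrossedProduct.instPartialOrder (α : G →* (A ≃⋆ₐ[ℂ] A)) :
    PartialOrder (CrossedProduct α) :=
  CStarAlgebra.spectralOrder (CrossedProduct α)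

instance CrossedProduct.instStarOrderedRing (α : G →* (A ≃⋆ₐ[ℂ] A)) :
    StarOrderedRing (CrossedProduct α) :=
  CStarAlgebra.spectralOrderedRing (CrossedProduct α)

end CrossedProduct

open Filter Topology

/-! ### Positive parts via functional calculus -/

section PosPart

variable {E : Type*} [CStarAlgebra E]

/-! Let E be the crossed product and f = ∑ f_g the sum of a Rokhlin tower. Since f nearly commutes
with A and is nearly G-invariant, it is nearly central in E, which is spanned by the a·u_g. "Nearly"
means convergence to zero along a filter of ever better towers (`AsympEq`).

For an exactly equivariant tower the elements f_g u_g would satisfy (f_g u_g)*(f_h u_h) = δ_{gh}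
f_1², hence span matrices over the hereditary algebra of f_1. In general f_g is replaced by a nearby
c_g with c_g* c_h = δ_{gh} α_g(a)², where a = (f_1 - η)₊: c_g comes from a polar decomposition
(`exists_close_polar`) and lies in the closed right ideal generated by √f_g, so orthogonality stays
exact. Then `exists_matrix_subalgebra`, applied to W_g = c_g u_g, gives B. The sum p = ∑ W_g W_g* =
∑ c_g c_g* lies in B and is close to f². Cutting it by functional calculus
(`exists_cuntzLE_one_sub`) yields d close to f² with 1 - d ≾ 1 - f² ≤ 2(1 - f).

To have 1 - f ≾ s, some nonzero positive t in A must lie Cuntz below s. Compression by f_g nearly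
kills all coefficients of s except the one at the identity, which gives such a t
(`exists_map_cuntzLE`). The same fact makes E simple. Finally, in a simple C*-algebra an
asymptotically central family of positive contractions with norms tending to 1 cannot shrink any
fixed element (`eventually_norm_sub_lt_norm_mul`), which gives the lower bound on ‖dxd‖. -/

lemma posPart_cfc {x : E} (hx : IsSelfAdjoint x) {g : ℝ → ℝ} (hg : Continuous g) :
    (cfc g x)⁺ = cfc (fun t : ℝ => (g t)⁺) x := by
  rw [CFC.posPart_def, cfcₙ_eq_cfc, ← cfc_comp' (fun t : ℝ => t⁺) g x]

lemma posPart_sub_algebraMap {x : E} (hx : IsSelfAdjoint x) (η : ℝ) :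
    (x - algebraMap ℝ E η)⁺ = cfc (fun t : ℝ => (t - η)⁺) x := by
  have h1 : x - algebraMap ℝ E η = cfc (fun t : ℝ => t - η) x := by
    rw [cfc_sub _ _ x, cfc_id' ℝ x, cfc_const η x]
  rw [h1, posPart_cfc hx (by fun_prop)]

lemma posPart_mul_self {x : E} (hx : IsSelfAdjoint x) : x⁺ * x = x⁺ * x⁺ := by
  nth_rw 2 [← CFC.posPart_sub_negPart x hx]
  rw [mul_sub, CFC.posPart_mul_negPart, sub_zero]

end PosPart

/-! ### Order and norm estimates in C*-algebras -/

section CStarBasics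

variable {E : Type*} [CStarAlgebra E] [PartialOrder E] [StarOrderedRing E]

/-- If `a a* ≤ r²` then left multiplication by `a` is dominated by left multiplication by `r`. -/
lemma norm_mul_le_norm_mul_of_mul_star_le {a r : E} (hr : IsSelfAdjoint r)
    (h : a * star a ≤ r * r) (x : E) : ‖x * a‖ ≤ ‖x * r‖ := by
  have h1 : x * (a * star a) * star x ≤ x * (r * r) * star x := star_right_conjugate_le_conjugate h x
  have h2 : ‖x * a‖ * ‖x * a‖ = ‖x * (a * star a) * star x‖ := by
    rw [← CStarRing.norm_self_mul_star]; simp only [star_mul, mul_assoc]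
  have h3 : ‖x * r‖ * ‖x * r‖ = ‖x * (r * r) * star x‖ := by
    rw [← CStarRing.norm_self_mul_star]; simp only [star_mul, mul_assoc, hr.star_eq]
  have h4 := CStarAlgebra.norm_le_norm_of_nonneg_of_le
    (star_right_conjugate_nonneg (mul_star_self_nonneg a) x) h1
  rw [← h2, ← h3] at h4
  exact (abs_le_of_sq_le_sq' (by nlinarith) (norm_nonneg _)).2

/-- Regularized inverses of a positive element. -/
lemma exists_approx_inverse {r : E} (hr : 0 ≤ r) :
    ∃ g : ℕ → E, (∀ k, 0 ≤ g k) ∧ (∀ k, Commute (g k) r) ∧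
      Tendsto (fun k => r * g k * r) atTop (𝓝 r) := by
  have hsp : ∀ t ∈ spectrum ℝ r, 0 ≤ t := fun t ht => spectrum_nonneg_of_nonneg hr ht
  have hδ : ∀ k : ℕ, (0 : ℝ) < 1 / (k + 1) := fun k => Nat.one_div_pos_of_nat
  have hc : ∀ k : ℕ, ContinuousOn (fun t : ℝ => (t + 1 / ((k : ℝ) + 1))⁻¹) (spectrum ℝ r) := by
    intro k
    refine ContinuousOn.inv₀ (by fun_prop) fun t ht => ?_
    have := hsp t ht
    have := hδ k
    positivity
  have hsa : IsSelfAdjoint r := IsSelfAdjoint.of_nonneg hr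
  refine ⟨fun k => cfc (fun t : ℝ => (t + 1 / ((k : ℝ) + 1))⁻¹) r, fun k => ?_, fun k => ?_, ?_⟩
  · refine cfc_nonneg fun t ht => ?_
    have := hsp t ht
    have := hδ k
    positivity
  · have := cfc_commute_cfc (R := ℝ) (fun t : ℝ => (t + 1 / ((k : ℝ) + 1))⁻¹) (fun t => t) r
    rwa [cfc_id' ℝ r] at this
  · rw [tendsto_iff_norm_sub_tendsto_zero]
    refine squeeze_zero (fun _ => norm_nonneg _) (fun k => ?_) tendsto_one_div_add_atTop_nhds_zero_nat
    have hck := hc k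
    have key : r * cfc (fun t : ℝ => (t + 1 / ((k : ℝ) + 1))⁻¹) r * r - r
        = cfc (fun t : ℝ => t * (t + 1 / ((k : ℝ) + 1))⁻¹ * t - t) r := by
      rw [cfc_sub _ _ r, cfc_mul _ _ r, cfc_mul _ _ r, cfc_id' ℝ r]
    rw [key]
    refine norm_cfc_le (hδ k).le fun t ht => ?_
    have h0 := hsp t ht
    have h1 := hδ k
    set δ : ℝ := 1 / ((k : ℝ) + 1)
    have h2 : t * (t + δ)⁻¹ * t - t = - (δ * (t / (t + δ))) := by
      field_simp; ring
    rw [h2, norm_neg, Real.norm_of_nonneg (by positivity)]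
    have : t / (t + δ) ≤ 1 := by rw [div_le_one (by positivity)]; linarith
    nlinarith

/-- Left multiplication by r g_k - 1 is at least as small on a as on r whenever a a* ≤ r², so one
sequence serves all such a. -/
lemma exists_approx_inverse_of_mul_star_le {r : E} (hr : 0 ≤ r) :
    ∃ g : ℕ → E, (∀ k, 0 ≤ g k) ∧ (∀ k, Commute (g k) r) ∧
      Tendsto (fun k => r * g k * r) atTop (𝓝 r) ∧
      ∀ a : E, a * star a ≤ r * r → Tendsto (fun k => r * g k * a) atTop (𝓝 a) := by
  obtain ⟨g, h0, hc, ht⟩ := exists_approx_inverse hr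
  refine ⟨g, h0, hc, ht, fun a ha => ?_⟩
  rw [tendsto_iff_norm_sub_tendsto_zero] at ht ⊢
  refine squeeze_zero (fun _ => norm_nonneg _) (fun k => ?_) ht
  have := norm_mul_le_norm_mul_of_mul_star_le (IsSelfAdjoint.of_nonneg hr) ha (r * g k - 1)
  simpa [sub_mul] using this

lemma norm_le_one_of_mul_self_le {p : E} (hp : IsSelfAdjoint p) (h : p * p ≤ p) : ‖p‖ ≤ 1 := by
  have h0 : 0 ≤ p * p := by simpa [hp.star_eq] using star_mul_self_nonneg p
  have h1 := CStarAlgebra.norm_le_norm_of_nonneg_of_le h0 h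
  have h2 : ‖p * p‖ = ‖p‖ * ‖p‖ := by
    simpa [hp.star_eq] using CStarRing.norm_star_mul_self (x := p)
  rw [h2] at h1
  by_contra hlt
  push Not at hlt
  nlinarith

lemma mul_self_le_self_of_norm_le_one {p : E} (hp : 0 ≤ p) (h : ‖p‖ ≤ 1) : p * p ≤ p := by
  have hs : 0 ≤ CFC.sqrt p := CFC.sqrt_nonneg p
  have hss : CFC.sqrt p * CFC.sqrt p = p := CFC.sqrt_mul_sqrt_self p hp
  have h1 : p ≤ 1 := (CStarAlgebra.norm_le_one_iff_of_nonneg p hp).1 h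
  have h2 := star_right_conjugate_le_conjugate h1 (CFC.sqrt p)
  rw [(IsSelfAdjoint.of_nonneg hs).star_eq, mul_one, hss] at h2
  calc p * p = CFC.sqrt p * (CFC.sqrt p * CFC.sqrt p) * CFC.sqrt p := by
        rw [← mul_assoc, hss, mul_assoc, hss]
    _ = CFC.sqrt p * p * CFC.sqrt p := by rw [hss]
    _ ≤ p := h2

lemma norm_le_of_neg_le_of_le {x : E} {c : ℝ} (hc : 0 ≤ c) (hx : IsSelfAdjoint x)
    (h1 : - algebraMap ℝ E c ≤ x) (h2 : x ≤ algebraMap ℝ E c) : ‖x‖ ≤ c := by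
  rw [← map_neg, algebraMap_le_iff_le_spectrum] at h1
  rw [le_algebraMap_iff_spectrum_le] at h2
  rw [← cfc_id' ℝ x]
  exact norm_cfc_le hc fun t ht => abs_le.2 ⟨h1 t ht, h2 t ht⟩

/-- With δ² = ‖a - b‖ one has a ≤ b + δ² ≤ (√b + δ)². Operator monotonicity of the square root gives
√a ≤ √b + δ, and the roles of a and b are symmetric. -/
lemma norm_sqrt_sub_sqrt_le {a b : E} (ha : 0 ≤ a) (hb : 0 ≤ b) :
    ‖CFC.sqrt a - CFC.sqrt b‖ ≤ √‖a - b‖ := by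
  have key : ∀ {a b : E}, 0 ≤ a → 0 ≤ b →
      CFC.sqrt a - CFC.sqrt b ≤ algebraMap ℝ E (√‖a - b‖) := by
    intro a b ha hb
    set δ := √‖a - b‖
    have hδ : δ * δ = ‖a - b‖ := Real.mul_self_sqrt (norm_nonneg _)
    have hδ0 : 0 ≤ δ := Real.sqrt_nonneg _
    have hD : 0 ≤ algebraMap ℝ E δ := algebraMap_nonneg E hδ0
    have hs : 0 ≤ CFC.sqrt b := CFC.sqrt_nonneg b
    have h1 : a - b ≤ algebraMap ℝ E ‖a - b‖ := IsSelfAdjoint.le_algebraMap_norm_self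
      ((IsSelfAdjoint.of_nonneg ha).sub (IsSelfAdjoint.of_nonneg hb))
    have hcomm : Commute (algebraMap ℝ E δ) (CFC.sqrt b) := Algebra.commutes _ _
    have h2 : a ≤ (CFC.sqrt b + algebraMap ℝ E δ) * (CFC.sqrt b + algebraMap ℝ E δ) := by
      have e1 : (CFC.sqrt b + algebraMap ℝ E δ) * (CFC.sqrt b + algebraMap ℝ E δ)
          = b + algebraMap ℝ E ‖a - b‖ + (2 * δ) • CFC.sqrt b := by
        rw [add_mul, mul_add, mul_add, CFC.sqrt_mul_sqrt_self b hb, ← hδ, map_mul, hcomm.eq,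
          ← Algebra.commutes δ, ← Algebra.smul_def, two_mul, add_smul]
        abel
      have e2 : 0 ≤ (2 * δ) • CFC.sqrt b := smul_nonneg (by positivity) hs
      rw [e1]
      calc a = b + (a - b) + 0 := by abel
        _ ≤ _ := by gcongr
    have h3 := CFC.sqrt_le_sqrt _ _ h2
    rw [CFC.sqrt_mul_self _ (add_nonneg hs hD)] at h3
    rwa [sub_le_iff_le_add']
  refine norm_le_of_neg_le_of_le (Real.sqrt_nonneg _)
    ((IsSelfAdjoint.of_nonneg (CFC.sqrt_nonneg a)).sub
      (IsSelfAdjoint.of_nonneg (CFC.sqrt_nonneg b))) ?_ (key ha hb)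
  have := key hb ha
  rw [norm_sub_rev] at this
  rw [neg_le, neg_sub]
  exact this

lemma Commute.sqrt_left {a b : E} (h : Commute a b) : Commute (CFC.sqrt a) b := by
  rw [CFC.sqrt_eq_cfc]
  exact h.cfc_nnreal _

/-- The square root of `x⁺` compresses `x` to `(x⁺)²`. -/
lemma sqrt_posPart_mul_mul {x : E} (hx : IsSelfAdjoint x) :
    CFC.sqrt x⁺ * x * CFC.sqrt x⁺ = x⁺ * x⁺ := by
  have hp : 0 ≤ x⁺ := CFC.posPart_nonneg x
  have hc : Commute (CFC.sqrt x⁺) x⁺ := (Commute.refl x⁺).sqrt_left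
  have hss : CFC.sqrt x⁺ * CFC.sqrt x⁺ = x⁺ := CFC.sqrt_mul_sqrt_self _ hp
  have hq : CFC.sqrt x⁺ * x⁻ = 0 := by
    have : Commute x⁺ x⁻ := by
      rw [commute_iff_eq, CFC.posPart_mul_negPart, CFC.negPart_mul_posPart]
    have h2 := this.sqrt_left
    rw [← CStarRing.star_mul_self_eq_zero_iff]
    rw [star_mul, (IsSelfAdjoint.of_nonneg (CFC.sqrt_nonneg x⁺)).star_eq, mul_assoc,
      ← mul_assoc (CFC.sqrt x⁺) (CFC.sqrt x⁺), hss, CFC.posPart_mul_negPart, mul_zero]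
  calc CFC.sqrt x⁺ * x * CFC.sqrt x⁺
      = CFC.sqrt x⁺ * (x⁺ - x⁻) * CFC.sqrt x⁺ := by rw [CFC.posPart_sub_negPart x hx]
    _ = x⁺ * (CFC.sqrt x⁺ * CFC.sqrt x⁺) := by
        rw [mul_sub, hq, sub_zero, hc.eq, mul_assoc]
    _ = x⁺ * x⁺ := by rw [hss]

lemma norm_posPart_sub_algebraMap_le {x : E} (hx : 0 ≤ x) (hx1 : ‖x‖ ≤ 1) {η : ℝ} (hη : 0 ≤ η) :
    ‖(x - algebraMap ℝ E η)⁺‖ ≤ 1 := by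
  rw [posPart_sub_algebraMap (IsSelfAdjoint.of_nonneg hx)]
  refine norm_cfc_le zero_le_one fun t ht => ?_
  have h1 : ‖t‖ ≤ 1 := by
    have := norm_apply_le_norm_cfc (fun t : ℝ => t) x ht
    rw [cfc_id' ℝ x] at this
    exact this.trans hx1
  have h2 := (abs_le.1 h1).2
  rw [Real.norm_of_nonneg (posPart_nonneg _), posPart_def]
  exact sup_le (by linarith) zero_le_one

lemma norm_sub_posPart_le {x : E} (hx : 0 ≤ x) {η : ℝ} (hη : 0 ≤ η) :
    ‖x - (x - algebraMap ℝ E η)⁺‖ ≤ η := by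
  have hsa := IsSelfAdjoint.of_nonneg hx
  rw [posPart_sub_algebraMap hsa]
  nth_rw 1 [← cfc_id' ℝ x]
  rw [← cfc_sub _ _ x]
  refine norm_cfc_le hη fun t ht => ?_
  have h0 : 0 ≤ t := spectrum_nonneg_of_nonneg hx ht
  rw [posPart_def, Real.norm_eq_abs, abs_le]
  rcases le_total (t - η) 0 with h | h
  · rw [sup_eq_right.2 h]; constructor <;> linarith
  · rw [sup_eq_left.2 h]; constructor <;> linarith

end CStarBasics

/-! ### Cuntz subequivalence -/

section Cuntz

variable {E : Type*} [CStarAlgebra E]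

lemma cuntzLE_iff {a b : E} :
    CuntzLE a b ↔ ∀ ε : ℝ, 0 < ε → ∃ z : E, ‖a - star z * b * z‖ < ε := by
  constructor
  · rintro ⟨x, hx⟩ ε hε
    obtain ⟨k, hk⟩ := (hx.eventually (gt_mem_nhds hε)).exists
    exact ⟨x k, hk⟩
  · intro h
    choose x hx using fun k : ℕ => h (1 / ((k : ℝ) + 1)) Nat.one_div_pos_of_nat
    exact ⟨x, squeeze_zero (fun _ => norm_nonneg _) (fun k => (hx k).le)
      tendsto_one_div_add_atTop_nhds_zero_nat⟩

lemma CuntzLE.trans {a b c : E} (hab : CuntzLE a b) (hbc : CuntzLE b c) : CuntzLE a c := by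
  rw [cuntzLE_iff] at *
  intro ε hε
  obtain ⟨z, hz⟩ := hab (ε / 2) (half_pos hε)
  obtain ⟨w, hw⟩ := hbc (ε / 2 / (‖z‖ * ‖z‖ + 1)) (by positivity)
  refine ⟨w * z, ?_⟩
  have h1 : a - star (w * z) * c * (w * z)
      = (a - star z * b * z) + star z * (b - star w * c * w) * z := by
    simp only [star_mul]; noncomm_ring
  have h2 : ‖star z * (b - star w * c * w) * z‖ ≤ ‖z‖ * ‖z‖ * ‖b - star w * c * w‖ := by
    calc _ ≤ ‖star z‖ * ‖b - star w * c * w‖ * ‖z‖ := by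
          exact (norm_mul_le _ _).trans (by gcongr; exact norm_mul_le _ _)
      _ = _ := by rw [norm_star]; ring
  have h3 : ‖z‖ * ‖z‖ * ‖b - star w * c * w‖ ≤ ε / 2 := by
    rw [lt_div_iff₀ (by positivity)] at hw
    nlinarith [norm_nonneg (b - star w * c * w)]
  rw [h1]
  calc _ ≤ _ := norm_add_le _ _
    _ < ε / 2 + ε / 2 := by linarith
    _ = ε := add_halves ε

lemma cuntzLE_star_mul_mul (b z : E) : CuntzLE (star z * b * z) b :=
  ⟨fun _ => z, by simp⟩

lemma cuntzLE_smul {c : ℝ} (hc : 0 ≤ c) (b : E) : CuntzLE (c • b) b := by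
  have := cuntzLE_star_mul_mul b (algebraMap ℝ E (√c))
  rwa [← algebraMap_star_comm, star_trivial, mul_assoc, ← Algebra.commutes, ← mul_assoc,
    ← map_mul, Real.mul_self_sqrt hc, ← Algebra.smul_def] at this

lemma CuntzLE.map {F : Type*} [CStarAlgebra F] {a b : E} (h : CuntzLE a b) (φ : E →⋆ₐ[ℂ] F) :
    CuntzLE (φ a) (φ b) := by
  rw [cuntzLE_iff] at *
  intro ε hε
  obtain ⟨z, hz⟩ := h ε hε
  refine ⟨φ z, lt_of_le_of_lt ?_ hz⟩
  simpa [map_star] using NonUnitalStarAlgHom.norm_apply_le φ (a - star z * b * z)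

variable [PartialOrder E] [StarOrderedRing E]

/-- With g_k the regularized inverses of √b, the elements √b g_k √a converge to √a, so z_k = g_k √a
works. -/
lemma cuntzLE_of_le {a b : E} (ha : 0 ≤ a) (hab : a ≤ b) : CuntzLE a b := by
  have hb : 0 ≤ b := ha.trans hab
  set r := CFC.sqrt b
  set s := CFC.sqrt a
  have hrr : r * r = b := CFC.sqrt_mul_sqrt_self b hb
  have hss : s * s = a := CFC.sqrt_mul_sqrt_self a ha
  have hs : star s = s := (IsSelfAdjoint.of_nonneg (CFC.sqrt_nonneg a)).star_eq
  have hr : star r = r := (IsSelfAdjoint.of_nonneg (CFC.sqrt_nonneg b)).star_eq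
  obtain ⟨g, h0, hc, -, ht⟩ := exists_approx_inverse_of_mul_star_le (r := r) (CFC.sqrt_nonneg b)
  have h1 := ht s (by rw [hs, hss, hrr]; exact hab)
  have h2 : Tendsto (fun k => star (r * g k * s) * (r * g k * s)) atTop (𝓝 a) := by
    have := h1.star.mul h1
    rwa [hs, hss] at this
  refine ⟨fun k => g k * s, ?_⟩
  have h3 : ∀ k, star (g k * s) * b * (g k * s) = star (r * g k * s) * (r * g k * s) := by
    intro k
    simp only [star_mul, hs, hr, ← hrr, mul_assoc]
  simp only [h3]
  simpa using (tendsto_const_nhds (x := a)).sub h2 |>.norm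

lemma cuntzLE_mul_self {w : E} (hw : 0 ≤ w) : CuntzLE w (w * w) := by
  obtain ⟨g, h0, hc, ht⟩ := exists_approx_inverse hw
  refine ⟨fun k => CFC.sqrt (g k), ?_⟩
  have h3 : ∀ k, star (CFC.sqrt (g k)) * (w * w) * CFC.sqrt (g k) = w * g k * w := by
    intro k
    have hk : Commute (CFC.sqrt (g k)) w := (hc k).sqrt_left
    rw [(IsSelfAdjoint.of_nonneg (CFC.sqrt_nonneg (g k))).star_eq, ← mul_assoc, hk.eq,
      mul_assoc, mul_assoc, ← hk.eq, ← mul_assoc _ _ w, CFC.sqrt_mul_sqrt_self _ (h0 k), mul_assoc]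
  simp only [h3]
  simpa using (tendsto_const_nhds (x := w)).sub ht |>.norm

/-- Conjugating c - ε ≤ b by the square root of (c - ε)₊ turns the left side into the square of (c -
ε)₊. -/
lemma cuntzLE_posPart_mul_self {c b : E} (hc : IsSelfAdjoint c) (hb : IsSelfAdjoint b) {ε : ℝ}
    (h : ‖c - b‖ ≤ ε) :
    CuntzLE ((c - algebraMap ℝ E ε)⁺ * (c - algebraMap ℝ E ε)⁺) b := by
  set x := c - algebraMap ℝ E ε
  have hx : IsSelfAdjoint x := hc.sub (IsSelfAdjoint.algebraMap E (IsSelfAdjoint.all ε))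
  have hk : IsSelfAdjoint (CFC.sqrt x⁺) := IsSelfAdjoint.of_nonneg (CFC.sqrt_nonneg _)
  have h1 : x ≤ b := by
    have h2 : c - b ≤ algebraMap ℝ E ‖c - b‖ := (hc.sub hb).le_algebraMap_norm_self
    have h3 : algebraMap ℝ E ‖c - b‖ ≤ algebraMap ℝ E ε := algebraMap_mono E h
    have := h2.trans h3
    rw [sub_le_iff_le_add] at this ⊢
    rwa [add_comm]
  have h4 := star_left_conjugate_le_conjugate h1 (CFC.sqrt x⁺)
  have h5 : star (CFC.sqrt x⁺) * x * CFC.sqrt x⁺ = x⁺ * x⁺ := by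
    rw [hk.star_eq, sqrt_posPart_mul_mul hx]
  rw [h5] at h4
  refine (cuntzLE_of_le ?_ h4).trans (cuntzLE_star_mul_mul _ _)
  simpa [(IsSelfAdjoint.of_nonneg (CFC.posPart_nonneg x)).star_eq] using star_mul_self_nonneg x⁺

lemma cuntzLE_posPart {c b : E} (hc : IsSelfAdjoint c) (hb : IsSelfAdjoint b) {ε : ℝ}
    (h : ‖c - b‖ ≤ ε) : CuntzLE (c - algebraMap ℝ E ε)⁺ b :=
  (cuntzLE_mul_self (CFC.posPart_nonneg _)).trans (cuntzLE_posPart_mul_self hc hb h)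

end Cuntz

/-! ### Polar decomposition and perturbation -/

section Polar

variable {E : Type*} [CStarAlgebra E] [PartialOrder E] [StarOrderedRing E]

/-- A polar decomposition: if `a² ≤ v* v` with `a` self-adjoint, then `a = |c|` for some `c`
in the closure of `vE`. -/
lemma exists_polar {a v : E} (ha : IsSelfAdjoint a) (h : a * a ≤ star v * v) :
    ∃ c : E, star c * c = a * a ∧ star v * c = CFC.sqrt (star v * v) * a ∧
      c ∈ closure (Set.range fun x => v * x) := by
  set r := CFC.sqrt (star v * v)
  have hr0 : 0 ≤ r := CFC.sqrt_nonneg _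
  have hr : star r = r := (IsSelfAdjoint.of_nonneg hr0).star_eq
  have hrr : r * r = star v * v := CFC.sqrt_mul_sqrt_self _ (star_mul_self_nonneg v)
  obtain ⟨g, h0, hc, htr, ht⟩ := exists_approx_inverse_of_mul_star_le hr0
  have hg : ∀ k, star (g k) = g k := fun k => (IsSelfAdjoint.of_nonneg (h0 k)).star_eq
  have hle : a * star a ≤ r * r := by rwa [ha.star_eq, hrr]
  have hta := ht a hle
  have hv : ∀ x : E, ‖v * x‖ = ‖r * x‖ := fun x => by
    have : ‖v * x‖ * ‖v * x‖ = ‖r * x‖ * ‖r * x‖ := by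
      rw [← CStarRing.norm_star_mul_self, ← CStarRing.norm_star_mul_self]
      simp only [star_mul, hr, mul_assoc]
      rw [← mul_assoc r r, hrr, mul_assoc]
    exact (mul_self_inj (norm_nonneg _) (norm_nonneg _)).1 this
  -- Formally c = v|v|⁻¹a. As ‖vx‖ = ‖rx‖ and a² ≤ r², the differences are dominated by those of the
  -- convergent sequence r g_k r.
  have hcau : CauchySeq fun k => v * (g k * a) := by
    have h1 := htr.cauchySeq
    rw [Metric.cauchySeq_iff] at h1 ⊢
    intro ε hε
    obtain ⟨N, hN⟩ := h1 ε hε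
    refine ⟨N, fun m hm n hn => lt_of_le_of_lt ?_ (hN m hm n hn)⟩
    rw [dist_eq_norm, dist_eq_norm]
    have h2 : v * (g m * a) - v * (g n * a) = v * ((g m - g n) * a) := by noncomm_ring
    have h3 : r * g m * r - r * g n * r = r * (g m - g n) * r := by noncomm_ring
    rw [h2, h3, hv, ← mul_assoc]
    exact norm_mul_le_norm_mul_of_mul_star_le (IsSelfAdjoint.of_nonneg hr0) hle _
  obtain ⟨c, hclim⟩ := cauchySeq_tendsto_of_complete hcau
  refine ⟨c, ?_, ?_, mem_closure_of_tendsto hclim (Eventually.of_forall fun k => ⟨_, rfl⟩)⟩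
  · refine tendsto_nhds_unique (hclim.star.mul hclim) ?_
    have := hta.star.mul hta
    rw [ha.star_eq] at this
    refine this.congr fun k => ?_
    simp only [star_mul, hr, mul_assoc]
    rw [← mul_assoc r r, hrr, mul_assoc]
  · refine tendsto_nhds_unique (hclim.const_mul (star v)) ?_
    refine (hta.const_mul r).congr fun k => ?_
    simp only [← mul_assoc, hrr]

/-- If `x` and `y` are close positive elements, then `(x - η)⁺` is the absolute value of an element
`c` of `closure (y E)` which is close to `(x - η)⁺`. -/
lemma exists_close_polar {x y : E} (hx : 0 ≤ x) (hx1 : ‖x‖ ≤ 1) (hy : 0 ≤ y) {η : ℝ}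
    (hη : ‖x - y‖ ≤ η) :
    ∃ c : E, star c * c = (x - algebraMap ℝ E η)⁺ * (x - algebraMap ℝ E η)⁺ ∧
      (∀ w, w * y = 0 → w * c = 0) ∧
      ‖c - (x - algebraMap ℝ E η)⁺‖ * ‖c - (x - algebraMap ℝ E η)⁺‖ ≤ 4 * √(2 * η) := by
  have hη0 : 0 ≤ η := (norm_nonneg _).trans hη
  have hxs := IsSelfAdjoint.of_nonneg hx
  have hys := IsSelfAdjoint.of_nonneg hy
  have hzs : IsSelfAdjoint (x - algebraMap ℝ E η) :=
    hxs.sub (IsSelfAdjoint.algebraMap E (IsSelfAdjoint.all η))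
  have hsq := sqrt_posPart_mul_mul hzs
  have hxa := norm_sub_posPart_le hx hη0
  have ha1 := norm_posPart_sub_algebraMap_le hx hx1 hη0
  have ha0 : 0 ≤ (x - algebraMap ℝ E η)⁺ := CFC.posPart_nonneg _
  set a := (x - algebraMap ℝ E η)⁺
  set e := CFC.sqrt a
  set q := CFC.sqrt y
  have has := IsSelfAdjoint.of_nonneg ha0
  have he0 : 0 ≤ e := CFC.sqrt_nonneg a
  have hes : star e = e := (IsSelfAdjoint.of_nonneg he0).star_eq
  have hqs : star q = q := (IsSelfAdjoint.of_nonneg (CFC.sqrt_nonneg y)).star_eq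
  have hee : e * e = a := CFC.sqrt_mul_sqrt_self a ha0
  have hqq : q * q = y := CFC.sqrt_mul_sqrt_self y hy
  have he1 : ‖e‖ ≤ 1 := by
    have h2 : ‖e‖ * ‖e‖ = ‖a‖ := by rw [← CStarRing.norm_star_mul_self, hes, hee]
    nlinarith [norm_nonneg e]
  have hle : x - algebraMap ℝ E η ≤ y := by
    have h2 : x - y ≤ algebraMap ℝ E ‖x - y‖ := (hxs.sub hys).le_algebraMap_norm_self
    have := h2.trans (algebraMap_mono E hη)
    rw [sub_le_iff_le_add] at this ⊢
    rwa [add_comm]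
  have ht : star (q * e) * (q * e) = e * y * e := by
    rw [star_mul, hes, hqs, mul_assoc, ← mul_assoc q, hqq, mul_assoc]
  -- Conjugate x - η ≤ y by e = √a, using e(x - η)e = a². The polar decomposition is then applied to
  -- v = qe, which is close to e² = a.
  have hat : a * a ≤ star (q * e) * (q * e) := by
    have := star_left_conjugate_le_conjugate hle e
    rwa [hes, hsq, ← ht] at this
  obtain ⟨c, hcc, hvc, hcl⟩ := exists_polar has hat
  refine ⟨c, hcc, fun w hw => ?_, ?_⟩
  · have hwq : w * q = 0 := by
      rw [← CStarRing.mul_star_self_eq_zero_iff, star_mul, hqs, mul_assoc, ← mul_assoc q, hqq,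
        ← mul_assoc, hw, zero_mul]
    have hclosed : IsClosed {z : E | w * z = 0} := isClosed_eq (by fun_prop) continuous_const
    refine hclosed.closure_subset_iff.2 ?_ hcl
    rintro _ ⟨z, rfl⟩
    show w * (q * e * z) = 0
    rw [← mul_assoc, ← mul_assoc, hwq, zero_mul, zero_mul]
  · have hc1 : ‖c‖ ≤ 1 := by
      have h2 : ‖c‖ * ‖c‖ = ‖a‖ * ‖a‖ := by
        rw [← CStarRing.norm_star_mul_self, hcc]
        nth_rw 1 [← has.star_eq]
        rw [CStarRing.norm_star_mul_self]
      rwa [(mul_self_inj (norm_nonneg _) (norm_nonneg _)).1 h2]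
    have hqe : ‖q - e‖ ≤ √(2 * η) := by
      refine (norm_sqrt_sub_sqrt_le hy ha0).trans (Real.sqrt_le_sqrt ?_)
      calc ‖y - a‖ = ‖(x - a) - (x - y)‖ := by congr 1; abel
        _ ≤ ‖x - a‖ + ‖x - y‖ := norm_sub_le _ _
        _ ≤ 2 * η := by linarith
    have hta : ‖CFC.sqrt (a * a) - CFC.sqrt (star (q * e) * (q * e))‖ ≤ √(2 * η) := by
      refine (norm_sqrt_sub_sqrt_le ?_ (star_mul_self_nonneg _)).trans (Real.sqrt_le_sqrt ?_)
      · simpa [has.star_eq] using star_mul_self_nonneg a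
      · have h2 : a * a - star (q * e) * (q * e) = e * ((x - y) - algebraMap ℝ E η) * e := by
          rw [ht, ← hsq]; noncomm_ring
        have h3 : ‖(x - y) - algebraMap ℝ E η‖ ≤ 2 * η := by
          have h4 : ‖algebraMap ℝ E η‖ ≤ η := by
            rw [norm_algebraMap, Real.norm_of_nonneg hη0]
            rcases subsingleton_or_nontrivial E with h | h
            · rw [Subsingleton.elim (1 : E) 0, norm_zero, mul_zero]; exact hη0
            · rw [CStarRing.norm_one, mul_one]
          exact (norm_sub_le _ _).trans (by linarith)
        rw [h2]
        calc _ ≤ ‖e‖ * ‖(x - y) - algebraMap ℝ E η‖ * ‖e‖ :=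
              (norm_mul_le _ _).trans (by gcongr; exact norm_mul_le _ _)
          _ ≤ 1 * (2 * η) * 1 := by gcongr
          _ = 2 * η := by ring
    rw [CFC.sqrt_mul_self a ha0] at hta
    set r := CFC.sqrt (star (q * e) * (q * e))
    have hac : ‖a * a - a * c‖ ≤ 2 * √(2 * η) := by
      -- Here v*c = ra reads eqc = ra, while e²c = ac.
      have h2 : a * a - a * c = (a - r) * a + e * (q - e) * c := by
        rw [sub_mul, ← hvc, star_mul, hes, hqs, mul_sub, hee, sub_mul]; abel
      rw [h2]
      calc _ ≤ ‖(a - r) * a‖ + ‖e * (q - e) * c‖ := norm_add_le _ _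
        _ ≤ ‖a - r‖ * ‖a‖ + ‖e‖ * ‖q - e‖ * ‖c‖ := by
            gcongr
            · exact norm_mul_le _ _
            · exact (norm_mul_le _ _).trans (by gcongr; exact norm_mul_le _ _)
        _ ≤ √(2 * η) * 1 + 1 * √(2 * η) * 1 := by gcongr
        _ = _ := by ring
    have hN : star (c - a) * (c - a) = (a * a - a * c) + star (a * a - a * c) := by
      rw [star_sub, star_sub, star_mul, star_mul, has.star_eq, sub_mul, mul_sub, mul_sub, hcc]
      abel
    rw [← CStarRing.norm_star_mul_self, hN]
    calc _ ≤ ‖a * a - a * c‖ + ‖star (a * a - a * c)‖ := norm_add_le _ _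
      _ ≤ 4 * √(2 * η) := by rw [norm_star]; linarith

end Polar

/-! ### Matrices over a hereditary subalgebra -/

section MatrixUnits

variable {A E : Type*} [CStarAlgebra A] [CStarAlgebra E]

lemma isClosed_hereditarySubalgebra {a : A} (ha : IsSelfAdjoint a) :
    IsClosed (hereditarySubalgebra a ha : Set A) :=
  NonUnitalStarSubalgebra.isClosed_topologicalClosure _

lemma mul_mul_mem_hereditarySubalgebra {a : A} (ha : IsSelfAdjoint a) (x : A) :
    a * x * a ∈ hereditarySubalgebra a ha :=
  subset_closure ⟨x, rfl⟩

/-- The map `x ↦ a x a` into the hereditary subalgebra generated by `a`. -/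
def compressionMap (a : A) (ha : IsSelfAdjoint a) : A →ₗ[ℂ] hereditarySubalgebra a ha where
  toFun x := ⟨a * x * a, mul_mul_mem_hereditarySubalgebra ha x⟩
  map_add' x y := Subtype.ext (by simp [mul_add, add_mul])
  map_smul' c x := Subtype.ext (by simp)

lemma denseRange_compressionMap {a : A} (ha : IsSelfAdjoint a) :
    DenseRange (compressionMap a ha) := by
  rintro ⟨y, hy⟩
  rw [closure_subtype]
  have h : (Subtype.val '' Set.range (compressionMap a ha)) = Set.range fun x : A => a * x * a := by
    ext z
    simp [compressionMap]
  rw [h]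
  exact hy

/-- The map `x ↦ v π(x) w*`. -/
def conjMap (π : A →⋆ₐ[ℂ] E) (v w : E) : A →ₗ[ℂ] E where
  toFun x := v * π x * star w
  map_add' x y := by simp [mul_add, add_mul]
  map_smul' c x := by simp

/-- The C*-identity lets π(a²) replace w*w and then v*v. Hence axa ↦ vπ(x)w* is well defined and
isometric, and extends to the closure of aAa. -/
lemma norm_conjMap {π : A →⋆ₐ[ℂ] E} (hπ : Function.Injective π) {a : A} (ha : IsSelfAdjoint a)
    {v w : E} (hv : star v * v = π (a * a)) (hw : star w * w = π (a * a)) (x : A) :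
    ‖conjMap π v w x‖ = ‖compressionMap a ha x‖ := by
  have h0 : ∀ y, ‖π y‖ = ‖y‖ := NonUnitalStarAlgHom.norm_map π hπ
  have h1 : ‖v * π x * star w‖ * ‖v * π x * star w‖ = ‖v * π (x * a)‖ * ‖v * π (x * a)‖ := by
    rw [← CStarRing.norm_self_mul_star, ← CStarRing.norm_self_mul_star]
    congr 1
    calc v * π x * star w * star (v * π x * star w)
        = v * π x * (star w * w) * star (π x) * star v := by
          simp only [star_mul, star_star, mul_assoc]
      _ = _ := by rw [hw]; simp only [star_mul, map_mul, ← map_star, ha.star_eq, mul_assoc]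
  have h2 : ‖v * π (x * a)‖ * ‖v * π (x * a)‖ = ‖a * x * a‖ * ‖a * x * a‖ := by
    rw [← h0 (a * x * a), ← CStarRing.norm_star_mul_self, ← CStarRing.norm_star_mul_self]
    congr 1
    calc star (v * π (x * a)) * (v * π (x * a)) = star (π (x * a)) * (star v * v) * π (x * a) := by
          simp only [star_mul, mul_assoc]
      _ = _ := by rw [hv]; simp only [star_mul, map_mul, ← map_star, ha.star_eq, mul_assoc]
  exact (mul_self_inj (norm_nonneg _) (norm_nonneg _)).1 (h1.trans h2)

variable {n : Type*} [Fintype n] [DecidableEq n]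

/-- Elements `W_j` with `W_j* W_k = δ_{jk} a²` span a copy of the matrices over the hereditary
subalgebra generated by `a`. -/
theorem exists_matrix_subalgebra {π : A →⋆ₐ[ℂ] E} (hπ : Function.Injective π) {a : A}
    (ha : IsSelfAdjoint a) (W : n → E)
    (hW : ∀ j k, star (W j) * W k = if j = k then π (a * a) else 0) :
    ∃ B : NonUnitalStarSubalgebra ℂ E, IsClosed (B : Set E) ∧
      Nonempty (B ≃⋆ₐ[ℂ] CStarMatrix n n (hereditarySubalgebra a ha)) ∧
      ∀ j k x, W j * π x * star (W k) ∈ B := by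
  have hcl : IsClosed (hereditarySubalgebra a ha : Set A) := isClosed_hereditarySubalgebra ha
  have hWW : ∀ j, star (W j) * W j = π (a * a) := fun j => by simp [hW]
  let φ : n → n → hereditarySubalgebra a ha →L[ℂ] E := fun j k =>
    (conjMap π (W j) (W k)).extendOfNorm (compressionMap a ha)
  have hφ : ∀ j k x, φ j k (compressionMap a ha x) = W j * π x * star (W k) := fun j k x =>
    LinearMap.extendOfNorm_eq (denseRange_compressionMap ha)
      ⟨1, fun x => by rw [one_mul, norm_conjMap hπ ha (hWW j) (hWW k)]⟩ x
  have hmul : ∀ j k k' l y z, φ j k y * φ k' l z = if k = k' then φ j l (y * z) else 0 := by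
    intro j k k' l y z
    refine (denseRange_compressionMap ha).induction_on₂ ?_ ?_ y z
    · split_ifs <;> exact isClosed_eq (by fun_prop) (by fun_prop)
    · intro x x'
      have h1 : compressionMap a ha x * compressionMap a ha x'
          = compressionMap a ha (x * (a * a) * x') :=
        Subtype.ext (by simp [compressionMap, mul_assoc])
      rw [h1, hφ, hφ, hφ]
      calc W j * π x * star (W k) * (W k' * π x' * star (W l))
          = W j * π x * (star (W k) * W k') * π x' * star (W l) := by simp only [mul_assoc]
        _ = _ := by
          rw [hW]
          split_ifs
          · simp only [map_mul, mul_assoc]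
          · simp
  have hstar : ∀ j k y, star (φ j k y) = φ k j (star y) := by
    intro j k y
    refine (denseRange_compressionMap ha).induction_on y (isClosed_eq ?_ ?_) ?_
    · exact continuous_star.comp (φ j k).continuous
    · exact (φ k j).continuous.comp continuous_star
    · intro x
      have h1 : star (compressionMap a ha x) = compressionMap a ha (star x) :=
        Subtype.ext (by simp [compressionMap, mul_assoc, ha.star_eq])
      rw [h1, hφ, hφ]
      simp only [star_mul, star_star, map_star, mul_assoc]
  have hnorm : ∀ j k y, ‖φ j k y‖ = ‖y‖ := by
    intro j k y
    refine (denseRange_compressionMap ha).induction_on y (isClosed_eq (by fun_prop) (by fun_prop)) ?_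
    intro x
    rw [hφ, ← norm_conjMap hπ ha (hWW j) (hWW k)]
    rfl
  let Φ : CStarMatrix n n (hereditarySubalgebra a ha) →⋆ₙₐ[ℂ] E :=
    { toFun := fun Y => ∑ j, ∑ k, φ j k (Y j k)
      map_smul' := fun c Y => by simp [Finset.smul_sum]
      map_zero' := by simp
      map_add' := fun Y Z => by simp [Finset.sum_add_distrib]
      map_mul' := fun Y Z => by
        simp only [CStarMatrix.mul_apply, map_sum, Finset.sum_mul, Finset.mul_sum, hmul,
          Finset.sum_ite_eq', Finset.mem_univ, if_true]
        refine Eq.trans (Finset.sum_congr rfl fun x _ => Finset.sum_comm) ?_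
        rw [Finset.sum_comm]
        exact Finset.sum_congr rfl fun k _ => Finset.sum_comm
      map_star' := fun Y => by
        simp only [star_sum, hstar]
        rw [Finset.sum_comm]
        rfl }
  have hΦ : Function.Injective Φ := by
    rw [injective_iff_map_eq_zero]
    intro Y hY
    ext1 k l
    -- Sandwiching by the adjoint of the entry isolates the entry y in the form y*yy*, whose
    -- vanishing forces y = 0; no unit or approximate unit is needed.
    have h1 : φ k k (star (Y k l)) * Φ Y * φ l l (star (Y k l))
        = φ k l (star (Y k l) * Y k l * star (Y k l)) := by
      show φ k k (star (Y k l)) * (∑ j, ∑ k, φ j k (Y j k)) * φ l l (star (Y k l)) = _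
      simp only [Finset.mul_sum, Finset.sum_mul, hmul, Finset.sum_ite_irrel,
        Finset.sum_const_zero, Finset.sum_ite_eq, Finset.sum_ite_eq', Finset.mem_univ, if_true]
    rw [hY, mul_zero, zero_mul] at h1
    have h2 : star (Y k l) * Y k l * star (Y k l) = 0 := by
      rw [← norm_eq_zero, ← hnorm k l, ← h1, norm_zero]
    have h3 : star (star (Y k l) * Y k l) * (star (Y k l) * Y k l) = 0 := by
      rw [star_mul, star_star, ← mul_assoc, h2, zero_mul]
    exact CStarRing.star_mul_self_eq_zero_iff _ |>.1 (CStarRing.star_mul_self_eq_zero_iff _ |>.1 h3)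
  refine ⟨NonUnitalStarAlgHom.range Φ, ?_, ⟨(StarAlgEquiv.ofInjective' Φ hΦ).symm⟩, ?_⟩
  · let _ : NonUnitalCStarAlgebra (hereditarySubalgebra a ha) :=
      NonUnitalStarSubalgebra.nonUnitalCStarAlgebra _ (h_closed := hcl)
    let _ : PartialOrder (hereditarySubalgebra a ha) := CStarAlgebra.spectralOrder _
    have _ : StarOrderedRing (hereditarySubalgebra a ha) := CStarAlgebra.spectralOrderedRing _
    rw [NonUnitalStarAlgHom.coe_range]
    exact (NonUnitalStarAlgHom.isometry Φ hΦ).isClosedEmbedding.isClosed_range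
  · intro j k x
    rw [← hφ]
    refine ⟨CStarMatrix.ofMatrix (Matrix.single j k (compressionMap a ha x)), ?_⟩
    show ∑ j', ∑ k', φ j' k' (Matrix.single j k (compressionMap a ha x) j' k') = _
    simp only [Matrix.single_apply, ite_and, apply_ite, map_zero, Finset.sum_ite_irrel,
      Finset.sum_const_zero, Finset.sum_ite_eq, Finset.mem_univ, if_true]

end MatrixUnits

/-! ### Asymptotic equality along a filter -/

section Asymptotics

variable {ι E : Type*} [NonUnitalNormedRing E] {l : Filter ι} {X X' Y Y' Z : ι → E}

/-- Two families agree asymptotically along a filter if their difference tends to zero. -/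
def AsympEq (l : Filter ι) (X Y : ι → E) : Prop :=
  Tendsto (fun i => X i - Y i) l (𝓝 0)

/-- A family which is bounded in norm. -/
def NormBounded (X : ι → E) : Prop := ∃ C, ∀ i, ‖X i‖ ≤ C

lemma NormBounded.const (x : E) : NormBounded (fun _ : ι => x) := ⟨‖x‖, fun _ => le_rfl⟩

lemma NormBounded.mul (hX : NormBounded X) (hY : NormBounded Y) :
    NormBounded fun i => X i * Y i := by
  obtain ⟨C, hC⟩ := hX
  obtain ⟨D, hD⟩ := hY
  exact ⟨C * D, fun i => (norm_mul_le _ _).trans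
    (mul_le_mul (hC i) (hD i) (norm_nonneg _) ((norm_nonneg _).trans (hC i)))⟩

lemma tendsto_zero_mul_of_normBounded (hX : Tendsto X l (𝓝 0)) (hY : NormBounded Y) :
    Tendsto (fun i => X i * Y i) l (𝓝 0) := by
  obtain ⟨C, hC⟩ := hY
  have h := (tendsto_zero_iff_norm_tendsto_zero.1 hX).mul_const C
  rw [zero_mul] at h
  exact squeeze_zero_norm (fun i => (norm_mul_le _ _).trans (by gcongr; exact hC i)) h

lemma tendsto_mul_zero_of_normBounded (hX : Tendsto X l (𝓝 0)) (hY : NormBounded Y) :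
    Tendsto (fun i => Y i * X i) l (𝓝 0) := by
  obtain ⟨C, hC⟩ := hY
  have h := (tendsto_zero_iff_norm_tendsto_zero.1 hX).const_mul C
  rw [mul_zero] at h
  exact squeeze_zero_norm (fun i => (norm_mul_le _ _).trans (by gcongr; exact hC i)) h

lemma AsympEq.refl (X : ι → E) : AsympEq l X X := by
  simpa [AsympEq] using tendsto_const_nhds

lemma AsympEq.of_eq (h : ∀ i, X i = Y i) : AsympEq l X Y := by
  rw [funext h]; exact .refl _

lemma AsympEq.symm (h : AsympEq l X Y) : AsympEq l Y X := by
  simpa [AsympEq] using h.neg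

lemma AsympEq.trans (h : AsympEq l X Y) (h' : AsympEq l Y Z) : AsympEq l X Z := by
  simpa [AsympEq] using Tendsto.add h h'

lemma AsympEq.congr (h : AsympEq l X Y) (hX : ∀ i, X i = X' i) (hY : ∀ i, Y i = Y' i) :
    AsympEq l X' Y' := by
  rwa [← funext hX, ← funext hY]

lemma AsympEq.sum {J : Type*} {s : Finset J} {X Y : J → ι → E}
    (h : ∀ j ∈ s, AsympEq l (X j) (Y j)) :
    AsympEq l (fun i => ∑ j ∈ s, X j i) fun i => ∑ j ∈ s, Y j i := by
  have := tendsto_finsetSum s h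
  simpa [AsympEq, Finset.sum_sub_distrib] using this

lemma AsympEq.mul_right (h : AsympEq l X Y) (hZ : NormBounded Z) :
    AsympEq l (fun i => X i * Z i) fun i => Y i * Z i :=
  (tendsto_zero_mul_of_normBounded h hZ).congr fun _ => sub_mul _ _ _

lemma AsympEq.mul_left (h : AsympEq l X Y) (hZ : NormBounded Z) :
    AsympEq l (fun i => Z i * X i) fun i => Z i * Y i :=
  (tendsto_mul_zero_of_normBounded h hZ).congr fun _ => mul_sub _ _ _

lemma AsympEq.mul (h : AsympEq l X Y) (h' : AsympEq l X' Y') (hX' : NormBounded X')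
    (hY : NormBounded Y) : AsympEq l (fun i => X i * X' i) fun i => Y i * Y' i :=
  (h.mul_right hX').trans (h'.mul_left hY)

lemma AsympEq.mono {l' : Filter ι} (h : AsympEq l X Y) (hl : l' ≤ l) : AsympEq l' X Y :=
  Tendsto.mono_left h hl

lemma AsympEq.eventually_norm_sub_lt (h : AsympEq l X Y) {ε : ℝ} (hε : 0 < ε) :
    ∀ᶠ i in l, ‖X i - Y i‖ < ε := by
  have := (tendsto_zero_iff_norm_tendsto_zero.1 h)
  exact this.eventually (gt_mem_nhds hε)

lemma AsympEq.map {F Φ : Type*} [NonUnitalNormedRing F] [FunLike Φ E F] [AddMonoidHomClass Φ E F]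
    (h : AsympEq l X Y) (φ : Φ) (hφ : ∀ x, ‖φ x‖ ≤ ‖x‖) :
    AsympEq l (fun i => φ (X i)) fun i => φ (Y i) := by
  refine squeeze_zero_norm (fun i => ?_) (tendsto_zero_iff_norm_tendsto_zero.1 h)
  rw [← map_sub]
  exact hφ _

lemma AsympEq.star_star [StarRing E] [NormedStarGroup E] (h : AsympEq l X Y) :
    AsympEq l (fun i => star (X i)) fun i => star (Y i) := by
  have := Tendsto.star h
  rw [star_zero] at this
  exact this.congr fun i => star_sub _ _

end Asymptotics

/-! ### Asymptotically central families in simple C*-algebras -/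

section AsymptoticallyCentral

variable {ι E : Type*} [CStarAlgebra E] {l : Filter ι} {e : ι → E}

lemma asympEq_pow_mul_comm (he : ∀ i, ‖e i‖ ≤ 1)
    (hcomm : ∀ x : E, AsympEq l (fun i => e i * x) fun i => x * e i) (m : ℕ) (x : E) :
    AsympEq l (fun i => e i ^ m * x) fun i => x * e i ^ m := by
  have hb : NormBounded e := ⟨1, he⟩
  have hbp : ∀ m, NormBounded fun i => e i ^ m := by
    intro m
    induction m with
    | zero => simpa using NormBounded.const (1 : E)
    | succ m ih => simpa [pow_succ] using ih.mul hb
  induction m with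
  | zero => simpa using AsympEq.refl _
  | succ m ih =>
    have h1 := (hcomm x).mul_left (hbp m)
    have h2 := ih.mul_right hb
    exact (h1.congr (fun i => by rw [pow_succ, mul_assoc]) (fun i => (mul_assoc _ _ _).symm)).trans
      (h2.congr (fun i => rfl) (fun i => by rw [pow_succ, mul_assoc]))

lemma norm_pow_mul_le (he : ∀ i, ‖e i‖ ≤ 1) (i : ι) {j m : ℕ} (h : j ≤ m) (y : E) :
    ‖e i ^ m * y‖ ≤ ‖e i ^ j * y‖ := by
  induction m, h using Nat.le_induction with
  | base => exact le_rfl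
  | succ m _ ih =>
    rw [pow_succ', mul_assoc]
    calc _ ≤ ‖e i‖ * ‖e i ^ m * y‖ := norm_mul_le _ _
      _ ≤ 1 * ‖e i ^ m * y‖ := by gcongr; exact he i
      _ ≤ _ := by rw [one_mul]; exact ih

/-- The elements asymptotically annihilated by high powers of an asymptotically central family. -/
def asympAnnihilator (l : Filter ι) (e : ι → E) (he : ∀ i, ‖e i‖ ≤ 1)
    (hcomm : ∀ x : E, AsympEq l (fun i => e i * x) fun i => x * e i) : TwoSidedIdeal E :=
  TwoSidedIdeal.mk' {y | ∀ c : ℝ, 0 < c → ∃ j : ℕ, ∀ᶠ i in l, ‖e i ^ j * y‖ < c}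
    (fun c hc => ⟨0, by simp [hc]⟩)
    (by
      intro x y hx hy c hc
      obtain ⟨j, hj⟩ := hx (c / 2) (half_pos hc)
      obtain ⟨k, hk⟩ := hy (c / 2) (half_pos hc)
      refine ⟨max j k, ?_⟩
      filter_upwards [hj, hk] with i h1 h2
      rw [mul_add]
      calc _ ≤ ‖e i ^ max j k * x‖ + ‖e i ^ max j k * y‖ := norm_add_le _ _
        _ ≤ ‖e i ^ j * x‖ + ‖e i ^ k * y‖ := add_le_add
          (norm_pow_mul_le he i (le_max_left _ _) x) (norm_pow_mul_le he i (le_max_right _ _) y)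
        _ < c := by linarith)
    (by
      intro x hx c hc
      simpa using hx c hc)
    (by
      intro x y hy c hc
      obtain ⟨j, hj⟩ := hy (c / 2 / (‖x‖ + 1)) (by positivity)
      refine ⟨j, ?_⟩
      have h2 := (asympEq_pow_mul_comm he hcomm j x).mul_right (NormBounded.const y)
      filter_upwards [hj, h2.eventually_norm_sub_lt (half_pos hc)] with i h1 h2
      rw [lt_div_iff₀ (by positivity)] at h1
      have h3 : ‖x * e i ^ j * y‖ ≤ ‖x‖ * ‖e i ^ j * y‖ := by
        rw [mul_assoc]; exact norm_mul_le _ _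
      have h4 : ‖e i ^ j * (x * y)‖ ≤ ‖e i ^ j * x * y - x * e i ^ j * y‖ + ‖x * e i ^ j * y‖ := by
        simpa [mul_assoc] using norm_add_le (e i ^ j * x * y - x * e i ^ j * y) (x * e i ^ j * y)
      nlinarith [norm_nonneg (e i ^ j * y)])
    (by
      intro x y hx c hc
      obtain ⟨j, hj⟩ := hx (c / (‖y‖ + 1)) (by positivity)
      refine ⟨j, ?_⟩
      filter_upwards [hj] with i h1
      rw [lt_div_iff₀ (by positivity)] at h1
      have h3 : ‖e i ^ j * (x * y)‖ ≤ ‖e i ^ j * x‖ * ‖y‖ := by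
        rw [← mul_assoc]; exact norm_mul_le _ _
      nlinarith [norm_nonneg (e i ^ j * x)])

lemma mem_asympAnnihilator {he : ∀ i, ‖e i‖ ≤ 1}
    {hcomm : ∀ x : E, AsympEq l (fun i => e i * x) fun i => x * e i} {y : E} :
    y ∈ asympAnnihilator l e he hcomm ↔
      ∀ c : ℝ, 0 < c → ∃ j : ℕ, ∀ᶠ i in l, ‖e i ^ j * y‖ < c :=
  TwoSidedIdeal.mem_mk' _ _ _ _ _ _ _

/-- In a simple C*-algebra, powers of an asymptotically central family of contractions of norm
close to one are bounded below on every nonzero element. -/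
lemma exists_frequently_le_norm_pow_mul [l.NeBot] (hE : IsSimpleCStar E)
    (hsa : ∀ i, IsSelfAdjoint (e i)) (he : ∀ i, ‖e i‖ ≤ 1)
    (hcomm : ∀ x : E, AsympEq l (fun i => e i * x) fun i => x * e i)
    (hone : Tendsto (fun i => ‖e i‖) l (𝓝 1)) {y : E} (hy : y ≠ 0) :
    ∃ c : ℝ, 0 < c ∧ ∀ j : ℕ, ∃ᶠ i in l, c ≤ ‖e i ^ j * y‖ := by
  have hclosed : IsClosed (asympAnnihilator l e he hcomm : Set E) := by
    rw [← closure_subset_iff_isClosed]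
    intro z hz
    rw [SetLike.mem_coe, mem_asympAnnihilator]
    intro c hc
    obtain ⟨z', hz', hd⟩ := Metric.mem_closure_iff.1 hz (c / 2) (half_pos hc)
    obtain ⟨j, hj⟩ := mem_asympAnnihilator.1 hz' (c / 2) (half_pos hc)
    refine ⟨j, ?_⟩
    filter_upwards [hj] with i h1
    rw [dist_eq_norm] at hd
    have h2 : ‖e i ^ j * (z - z')‖ ≤ ‖e i ^ 0 * (z - z')‖ := norm_pow_mul_le he i (Nat.zero_le j) _
    rw [pow_zero, one_mul] at h2
    calc ‖e i ^ j * z‖ = ‖e i ^ j * (z - z') + e i ^ j * z'‖ := by rw [← mul_add, sub_add_cancel]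
      _ ≤ ‖e i ^ j * (z - z')‖ + ‖e i ^ j * z'‖ := norm_add_le _ _
      _ < c := by linarith
  have hproper : asympAnnihilator l e he hcomm ≠ ⊤ := by
    intro h
    have h1 : (1 : E) ∈ asympAnnihilator l e he hcomm := by rw [h]; trivial
    obtain ⟨j, hj⟩ := mem_asympAnnihilator.1 h1 (1 / 2) (by norm_num)
    -- Exponents 2^j are used because ‖e^(2^j)‖ = ‖e‖^(2^j) for self-adjoint e; so no power of e is
    -- asymptotically small and the ideal omits 1.
    have h2 : Tendsto (fun i => ‖e i‖ ^ 2 ^ j) l (𝓝 1) := by simpa using hone.pow (2 ^ j)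
    have h3 := h2.eventually (lt_mem_nhds (show (1 / 2 : ℝ) < 1 by norm_num))
    obtain ⟨i, h4, h5⟩ := (hj.and h3).exists
    have h6 := norm_pow_mul_le he i (Nat.lt_two_pow_self (n := j)).le 1
    rw [mul_one, mul_one, (hsa i).norm_pow_two_pow] at h6
    rw [mul_one] at h4
    linarith
  have hbot := (hE.2 _ hclosed).resolve_right hproper
  have hy' : y ∉ asympAnnihilator l e he hcomm := by
    rw [hbot]
    simpa using hy
  rw [mem_asympAnnihilator] at hy'
  push Not at hy'
  exact hy'

variable [PartialOrder E] [StarOrderedRing E]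

/-- This follows from β² ≤ (y + β)², passing to adjoints to turn right multiplication into left
multiplication. -/
lemma mul_norm_le_norm_add_mul {y : E} (hy : 0 ≤ y) {β : ℝ} (hβ : 0 ≤ β) (w : E) :
    β * ‖w‖ ≤ ‖(y + algebraMap ℝ E β) * w‖ := by
  have hsb : IsSelfAdjoint (algebraMap ℝ E β) := IsSelfAdjoint.algebraMap E (IsSelfAdjoint.all β)
  have hsa : IsSelfAdjoint (y + algebraMap ℝ E β) := (IsSelfAdjoint.of_nonneg hy).add hsb
  have hc : algebraMap ℝ E β * y = β • y := (Algebra.smul_def β y).symm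
  have hc' : y * algebraMap ℝ E β = β • y := by rw [← Algebra.commutes, hc]
  have h := norm_mul_le_norm_mul_of_mul_star_le (a := algebraMap ℝ E β) hsa ?_ (star w)
  · rw [← norm_star, ← norm_star (star w * (y + _)), star_mul, star_mul, star_star, hsa.star_eq,
      hsb.star_eq, ← Algebra.smul_def, norm_smul, Real.norm_of_nonneg hβ] at h
    exact h
  · have h0 : 0 ≤ y * y := by
      simpa [(IsSelfAdjoint.of_nonneg hy).star_eq] using star_mul_self_nonneg y
    have h1 : 0 ≤ β • y := smul_nonneg hβ hy
    rw [hsb.star_eq, mul_add, add_mul, add_mul, hc, hc']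
    exact le_add_of_nonneg_left (add_nonneg (add_nonneg h0 h1) h1) |>.trans_eq (by abel)

/-- An asymptotically central family of positive contractions of norm close to one in a simple
C*-algebra asymptotically preserves norms. -/
theorem eventually_norm_sub_lt_norm_mul (hE : IsSimpleCStar E)
    (hpos : ∀ i, 0 ≤ e i) (he : ∀ i, ‖e i‖ ≤ 1)
    (hcomm : ∀ x : E, AsympEq l (fun i => e i * x) fun i => x * e i)
    (hone : Tendsto (fun i => ‖e i‖) l (𝓝 1)) (x : E) {ε : ℝ} (hε : 0 < ε) :
    ∀ᶠ i in l, ‖x‖ - ε < ‖e i * x‖ := by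
  by_contra hbad
  rw [not_eventually] at hbad
  set γ := ‖x‖ - ε
  -- Restrict to the indices where the bound fails; there ‖e b e‖ ≤ γ² for b = xx*.
  set l' := l ⊓ 𝓟 {i | ¬ γ < ‖e i * x‖}
  have hl' : l'.NeBot := frequently_mem_iff_neBot.1 hbad
  have hγ : ∀ᶠ i in l', ‖e i * x‖ ≤ γ := by
    have : ∀ᶠ i in l', i ∈ {i | ¬ γ < ‖e i * x‖} := mem_inf_of_right (mem_principal_self _)
    exact this.mono fun i hi => not_lt.1 hi
  have hγ0 : 0 ≤ γ := by
    obtain ⟨i, hi⟩ := hγ.exists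
    exact (norm_nonneg _).trans hi
  have hsa : ∀ i, IsSelfAdjoint (e i) := fun i => IsSelfAdjoint.of_nonneg (hpos i)
  have hcomm' : ∀ x : E, AsympEq l' (fun i => e i * x) fun i => x * e i :=
    fun x => (hcomm x).mono inf_le_left
  have hb : NormBounded e := ⟨1, he⟩
  have hlt : γ < ‖x‖ := sub_lt_self _ hε
  set b := x * star x
  have hb0 : 0 ≤ b := mul_star_self_nonneg x
  have hbn : ‖b‖ = ‖x‖ * ‖x‖ := CStarRing.norm_self_mul_star
  -- β < ‖b‖ makes the spectral cut-off y = (b - β)₊ nonzero; γ² < β makes (γ²/β)^j tend to 0.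
  obtain ⟨β, hβ1, hβ2⟩ := exists_between (mul_self_lt_mul_self hγ0 hlt)
  have hβ0 : 0 < β := (mul_self_nonneg γ).trans_lt hβ1
  have hbs : IsSelfAdjoint (b - algebraMap ℝ E β) :=
    (IsSelfAdjoint.of_nonneg hb0).sub (IsSelfAdjoint.algebraMap E (IsSelfAdjoint.all β))
  set y := (b - algebraMap ℝ E β)⁺
  have hy0 : 0 ≤ y := CFC.posPart_nonneg _
  have hyne : y ≠ 0 := by
    intro h
    rw [CFC.posPart_eq_zero_iff _ hbs, sub_nonpos] at h
    have := (CStarAlgebra.norm_le_iff_le_algebraMap b hβ0.le hb0).2 h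
    rw [hbn] at this
    linarith
  have hyb : y * b = (y + algebraMap ℝ E β) * y := by
    have := posPart_mul_self hbs
    rw [mul_sub, sub_eq_iff_eq_add] at this
    rw [this, add_mul, Algebra.commutes]
  -- Since yb = (y + β)y, each factor b next to y expands norms by at least β.
  have hlow : ∀ (j : ℕ) (w : E), β ^ j * ‖y * w‖ ≤ ‖y * b ^ j * w‖ := by
    intro j
    induction j with
    | zero => intro w; simp
    | succ j ih =>
      intro w
      have h1 := mul_norm_le_norm_add_mul hy0 hβ0.le (y * w)
      rw [← mul_assoc, ← hyb] at h1
      have h2 := ih (b * w)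
      rw [pow_succ, mul_assoc]
      calc β ^ j * (β * ‖y * w‖) ≤ β ^ j * ‖y * (b * w)‖ := by
            rw [← mul_assoc y]; gcongr
        _ ≤ _ := h2
        _ = _ := by simp only [pow_succ, mul_assoc]
  obtain ⟨c, hc0, hc⟩ := exists_frequently_le_norm_pow_mul hE hsa he hcomm'
    (hone.mono_left inf_le_left) hyne
  have hbe : NormBounded fun i => e i * b * e i := (hb.mul (.const b)).mul hb
  have happ : ∀ j : ℕ, AsympEq l' (fun i => (e i * b * e i) ^ j) fun i => b ^ j * e i ^ (2 * j) := by
    intro j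
    induction j with
    | zero => simpa using AsympEq.refl _
    | succ j ih =>
      have h1 := ih.mul_right hbe
      have h2 := ((asympEq_pow_mul_comm he hcomm' (2 * j + 1) b).mul_left
        (NormBounded.const (b ^ j))).mul_right hb
      exact (h1.congr (Y' := fun i => b ^ j * (e i ^ (2 * j + 1) * b) * e i)
        (fun i => (pow_succ _ _).symm)
        (fun i => by rw [pow_succ (e i) (2 * j)]; simp only [mul_assoc])).trans
        (h2.congr (fun i => rfl)
          (fun i => by simp only [pow_succ, mul_assoc, Nat.mul_succ]))
  -- Compare y(ebe)^j, bounded by ‖y‖γ^(2j), with y b^j e^(2j), bounded below by β^j‖y e^(2j)‖.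
  -- Simplicity provides c independent of j, so j → ∞ is contradictory.
  have hkey : ∀ j : ℕ, β ^ j * c ≤ ‖y‖ * (γ * γ) ^ j := by
    intro j
    by_contra hlt
    push Not at hlt
    -- Commuting e^(2j) past y costs β^j δ, replacing (ebe)^j costs δ, and the last summand leaves a
    -- strict margin.
    set δ := (β ^ j * c - ‖y‖ * (γ * γ) ^ j) / (β ^ j + 1 + 1)
    have hβj : 0 < β ^ j := by positivity
    have hδ : 0 < δ := div_pos (sub_pos.2 hlt) (by positivity)
    have hδe : δ * (β ^ j + 1 + 1) = β ^ j * c - ‖y‖ * (γ * γ) ^ j :=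
      div_mul_cancel₀ _ (by positivity)
    have h1 := ((happ j).mul_left (NormBounded.const y)).eventually_norm_sub_lt hδ
    have h2 := (asympEq_pow_mul_comm he hcomm' (2 * j) y).eventually_norm_sub_lt hδ
    obtain ⟨i, h3, h4, h5, h6⟩ := ((hc (2 * j)).and_eventually (h1.and (h2.and hγ))).exists
    have h7 : ‖(e i * b * e i) ^ j‖ ≤ (γ * γ) ^ j := by
      have h8 : ‖e i * b * e i‖ ≤ γ * γ := by
        have : e i * b * e i = (e i * x) * star (e i * x) := by
          rw [star_mul, (hsa i).star_eq]; simp only [b, mul_assoc]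
        rw [this, CStarRing.norm_self_mul_star]
        exact mul_self_le_mul_self (norm_nonneg _) h6
      have := hE.1
      exact (norm_pow_le _ _).trans (pow_le_pow_left₀ (norm_nonneg _) h8 _)
    have h9 : ‖y * (e i * b * e i) ^ j‖ ≤ ‖y‖ * (γ * γ) ^ j :=
      (norm_mul_le _ _).trans (by gcongr)
    have h10 := hlow j (e i ^ (2 * j))
    rw [mul_assoc] at h10
    have h11 : ‖y * (b ^ j * e i ^ (2 * j))‖ ≤ ‖y * (e i * b * e i) ^ j‖ + δ := by
      have := norm_sub_norm_le (y * (b ^ j * e i ^ (2 * j))) (y * (e i * b * e i) ^ j)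
      rw [norm_sub_rev] at this
      linarith
    have h12 : c - δ ≤ ‖y * e i ^ (2 * j)‖ := by
      have := norm_sub_norm_le (e i ^ (2 * j) * y) (y * e i ^ (2 * j))
      linarith
    have h13 : β ^ j * (c - δ) ≤ β ^ j * ‖y * e i ^ (2 * j)‖ := by gcongr
    nlinarith
  have hlim : Tendsto (fun j : ℕ => ‖y‖ * (γ * γ / β) ^ j) atTop (𝓝 (‖y‖ * 0)) :=
    (tendsto_pow_atTop_nhds_zero_of_lt_one (by positivity)
      ((div_lt_one hβ0).2 hβ1)).const_mul _
  rw [mul_zero] at hlim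
  obtain ⟨j, hj⟩ := (hlim.eventually (gt_mem_nhds hc0)).exists
  have := hkey j
  rw [div_pow, ← mul_div_assoc, div_lt_iff₀ (by positivity)] at hj
  linarith

end AsymptoticallyCentral

/-! ### Covariant representations and coefficients -/

section CovariantRep

variable {A E G : Type*} [CStarAlgebra A] [CStarAlgebra E] [Group G] [Fintype G]

/-- A faithful covariant representation `(π, u)` of `(G, A, α)` in `E` for which `E` is spanned by
the elements `π(a) u_g`. -/
structure IsCovariantSpan (α : G →* (A ≃⋆ₐ[ℂ] A)) (π : A →⋆ₐ[ℂ] E) (u : G → E) : Prop where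
  injective : Function.Injective π
  one : u 1 = 1
  mul : ∀ g h, u (g * h) = u g * u h
  star_eq : ∀ g, star (u g) = u g⁻¹
  covariant : ∀ g a, u g * π a = π (α g a) * u g
  exists_sum : ∀ x, ∃ c : G → A, x = ∑ g, π (c g) * u g

namespace IsCovariantSpan

variable {α : G →* (A ≃⋆ₐ[ℂ] A)} {π : A →⋆ₐ[ℂ] E} {u : G → E}

lemma norm_map (h : IsCovariantSpan α π u) (a : A) : ‖π a‖ = ‖a‖ :=
  NonUnitalStarAlgHom.norm_map π h.injective a

lemma inv_mul (h : IsCovariantSpan α π u) (g : G) : u g⁻¹ * u g = 1 := by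
  rw [← h.mul, inv_mul_cancel, h.one]

/-- A nonzero positive element has a nonzero positive coefficient at the identity. -/
lemma exists_coeff_of_nonneg [PartialOrder A] [StarOrderedRing A] [PartialOrder E]
    [StarOrderedRing E] (h : IsCovariantSpan α π u) {s : E} (hs : 0 ≤ s) (hs0 : s ≠ 0) :
    ∃ c : G → A, s = ∑ g, π (c g) * u g ∧ 0 ≤ c 1 ∧ c 1 ≠ 0 := by
  obtain ⟨m, hm⟩ := h.exists_sum (CFC.sqrt s)
  have hss : star (CFC.sqrt s) * CFC.sqrt s = s := by
    rw [(IsSelfAdjoint.of_nonneg (CFC.sqrt_nonneg s)).star_eq, CFC.sqrt_mul_sqrt_self s hs]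
  have h1 : ∑ g, α g⁻¹ (star (m g) * m (g * 1)) = ∑ g, star (α g⁻¹ (m g)) * α g⁻¹ (m g) := by
    simp only [mul_one, map_mul, map_star]
  -- These are the coefficients of (√s)*√s, where √s = ∑ m_g u_g; at the identity they form a sum of
  -- squares.
  refine ⟨fun k => ∑ g, α g⁻¹ (star (m g) * m (g * k)), ?_, ?_, ?_⟩
  · nth_rw 1 [← hss]
    rw [hm]
    simp only [star_sum, Finset.sum_mul, Finset.mul_sum, map_sum]
    rw [Finset.sum_comm]
    nth_rw 2 [Finset.sum_comm]
    refine Finset.sum_congr rfl fun g _ => ?_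
    refine (Fintype.sum_equiv (Equiv.mulLeft g) _ _ fun k => ?_).symm
    rw [Equiv.coe_mulLeft, star_mul, h.star_eq, ← map_star, mul_assoc, ← mul_assoc (π _) (π _),
      ← map_mul, ← mul_assoc, h.covariant, mul_assoc, ← h.mul, inv_mul_cancel_left]
  · show 0 ≤ ∑ g, α g⁻¹ (star (m g) * m (g * 1))
    rw [h1]
    exact Finset.sum_nonneg fun g _ => star_mul_self_nonneg _
  · show ∑ g, α g⁻¹ (star (m g) * m (g * 1)) ≠ 0
    rw [h1]
    intro h2
    rw [Finset.sum_eq_zero_iff_of_nonneg fun g _ => star_mul_self_nonneg _] at h2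
    have h3 : ∀ g, m g = 0 := fun g => by
      have := CStarRing.star_mul_self_eq_zero_iff _ |>.1 (h2 g (Finset.mem_univ g))
      simpa using this
    apply hs0
    rw [← hss, hm]
    simp [h3]

end IsCovariantSpan

end CovariantRep

lemma map_posPart_sub {A E : Type*} [CStarAlgebra A] [CStarAlgebra E] (π : A →⋆ₐ[ℂ] E) {x : A}
    (hx : IsSelfAdjoint x) (η : ℝ) :
    π (x - algebraMap ℝ A η)⁺ = (π x - algebraMap ℝ E η)⁺ := by
  rw [posPart_sub_algebraMap hx, StarAlgHomClass.map_cfc π _ x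
    (hφ := AddMonoidHomClass.continuous_of_bound π 1 fun y => by
      simpa using NonUnitalStarAlgHom.norm_apply_le π y), posPart_sub_algebraMap (hx.map π)]

/-! ### Nets of Rokhlin towers and simplicity of the crossed product -/

section RokhlinNet

variable {A G : Type*} [CStarAlgebra A] [PartialOrder A] [StarOrderedRing A]
  [Group G] [Fintype G]

/-- A family of Rokhlin towers which is asymptotically central and equivariant. -/
structure IsRokhlinNet {ι : Type*} (α : G →* (A ≃⋆ₐ[ℂ] A)) (l : Filter ι) (f : ι → G → A) :
    Prop where
  nonneg : ∀ i g, 0 ≤ f i g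
  norm_le_one : ∀ i g, ‖f i g‖ ≤ 1
  orthogonal : ∀ i g h, g ≠ h → f i g * f i h = 0
  comm : ∀ x g, AsympEq l (fun i => f i g * x) fun i => x * f i g
  equivariant : ∀ g h, AsympEq l (fun i => α g (f i h)) fun i => f i (g * h)

/-- The index (F, k) carries a tower for the finite set F and tolerance 1/(k+1), so each fixed x
eventually belongs to F. -/
lemma WeakTracialRokhlin.exists_net {α : G →* (A ≃⋆ₐ[ℂ] A)} (hα : WeakTracialRokhlin α) {s : A}
    (hs : 0 ≤ s) (hs1 : ‖s‖ = 1) :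
    ∃ (l : Filter (Finset A × ℕ)) (_ : l.NeBot) (f : Finset A × ℕ → G → A), IsRokhlinNet α l f ∧
      (∀ i, CuntzLE (1 - ∑ g, f i g) s) ∧
      ∀ ε : ℝ, 0 < ε → ∀ᶠ i in l, 1 - ε < ‖(∑ g, f i g) * s * ∑ g, f i g‖ := by
  classical
  choose f hf using fun i : Finset A × ℕ =>
    hα i.1 (1 / ((i.2 : ℝ) + 1)) Nat.one_div_pos_of_nat s hs hs1
  have hsnd : Tendsto (fun i : Finset A × ℕ => 1 / ((i.2 : ℝ) + 1)) atTop (𝓝 0) := by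
    have h1 : Tendsto (fun i : Finset A × ℕ => i.2) atTop atTop := by
      rw [← prod_atTop_atTop_eq]; exact tendsto_snd
    exact tendsto_one_div_add_atTop_nhds_zero_nat.comp h1
  refine ⟨atTop, inferInstance, f, ⟨fun i g => ((hf i).1 g).1, fun i g => ((hf i).1 g).2,
    fun i => (hf i).2.1, fun x g => ?_, fun g h => ?_⟩, fun i => (hf i).2.2.2.2.1, fun ε hε => ?_⟩
  · refine squeeze_zero_norm' ?_ hsnd
    filter_upwards [eventually_ge_atTop (({x}, 0) : Finset A × ℕ)] with i hi
    exact ((hf i).2.2.1 x (hi.1 (Finset.mem_singleton_self x)) g).le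
  · exact squeeze_zero_norm (fun i => ((hf i).2.2.2.1 g h).le) hsnd
  · filter_upwards [hsnd.eventually (gt_mem_nhds hε)] with i hi
    have := (hf i).2.2.2.2.2
    linarith

namespace IsRokhlinNet

variable {ι : Type*} {α : G →* (A ≃⋆ₐ[ℂ] A)} {l : Filter ι} {f : ι → G → A}

lemma normBounded (hf : IsRokhlinNet α l f) (g : G) : NormBounded fun i => f i g :=
  ⟨1, fun i => hf.norm_le_one i g⟩

lemma mul_mul_asympEq (hf : IsRokhlinNet α l f) (x : A) (g h : G) :
    AsympEq l (fun i => f i g * x * f i h) fun i => x * (f i g * f i h) :=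
  ((hf.comm x g).mul_right (hf.normBounded h)).congr (fun _ => rfl) fun _ => mul_assoc _ _ _

lemma mul_mul_asympEq_zero (hf : IsRokhlinNet α l f) (x : A) {g h : G} (hgh : g ≠ h) :
    AsympEq l (fun i => f i g * x * f i h) fun _ => 0 :=
  (hf.mul_mul_asympEq x g h).congr (fun _ => rfl) fun i => by rw [hf.orthogonal i g h hgh, mul_zero]

/-- The off-diagonal terms satisfy f_g x f_h ≈ x f_g f_h = 0. -/
lemma compress_asympEq (hf : IsRokhlinNet α l f) (x : A) :
    AsympEq l (fun i => (∑ g, f i g) * x * ∑ g, f i g) fun i => ∑ g, f i g * x * f i g := by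
  classical
  have h : AsympEq l (fun i => ∑ g, ∑ h, f i g * x * f i h)
      fun i => ∑ g, ∑ h, if g = h then f i g * x * f i h else 0 := by
    refine AsympEq.sum fun g _ => AsympEq.sum fun h _ => ?_
    by_cases hgh : g = h
    · simpa [hgh] using AsympEq.refl _
    · simpa [hgh] using hf.mul_mul_asympEq_zero x hgh
  refine h.congr (fun i => ?_) fun i => by simp
  simp only [Finset.sum_mul, Finset.mul_sum]
  exact Finset.sum_comm

lemma mul_mul_map_asympEq (hf : IsRokhlinNet α l f) (x : A) (g h : G) :
    AsympEq l (fun i => f i g * x * α h (f i g)) fun i => f i g * x * f i (h * g) :=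
  (hf.equivariant h g).mul_left ((hf.normBounded g).mul (.const x))

variable {E : Type*} [CStarAlgebra E] {π : A →⋆ₐ[ℂ] E} {u : G → E}

/-- Compression by a Rokhlin tower asymptotically implements the conditional expectation. -/
lemma map_compress_asympEq (hf : IsRokhlinNet α l f) (hu : IsCovariantSpan α π u) (c : G → A)
    (g : G) : AsympEq l (fun i => π (f i g) * (∑ h, π (c h) * u h) * π (f i g))
      fun i => π (f i g * c 1 * f i g) := by
  classical
  have h : AsympEq l (fun i => ∑ h, π (f i g * c h * α h (f i g)) * u h)
      fun i => ∑ h : G, if h = 1 then π (f i g * c 1 * f i g) else 0 := by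
    refine AsympEq.sum fun h _ => ?_
    by_cases hh : h = 1
    · refine AsympEq.of_eq fun i => ?_
      rw [hh, if_pos rfl, hu.one, mul_one, map_one α]
      rfl
    · have h1 := (hf.mul_mul_map_asympEq (c h) g h).trans
        (hf.mul_mul_asympEq_zero (c h) (g := g) (h := h * g) (by simpa using hh))
      have h2 := (h1.map π fun x => (hu.norm_map x).le).mul_right (NormBounded.const (u h))
      refine h2.congr (fun _ => rfl) fun i => ?_
      rw [map_zero, zero_mul, if_neg hh]
  refine h.congr (fun i => ?_) fun i => by simp
  simp only [Finset.mul_sum, Finset.sum_mul]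
  refine Finset.sum_congr rfl fun h _ => ?_
  rw [mul_assoc (π (f i g)), mul_assoc (π (c h)), hu.covariant]
  simp only [map_mul, mul_assoc]

end IsRokhlinNet

variable {E : Type*} [CStarAlgebra E] [PartialOrder E] [StarOrderedRing E]
  {α : G →* (A ≃⋆ₐ[ℂ] A)} {π : A →⋆ₐ[ℂ] E} {u : G → E}

/-- Every nonzero positive element of the crossed product dominates a nonzero positive element of
the coefficient algebra. -/
theorem exists_map_cuntzLE (hα : WeakTracialRokhlin α) (hu : IsCovariantSpan α π u)
    {s : E} (hs : 0 ≤ s) (hs0 : s ≠ 0) :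
    ∃ t : A, 0 ≤ t ∧ t ≠ 0 ∧ CuntzLE (π t) s := by
  obtain ⟨c, hc, hx, hx0⟩ := hu.exists_coeff_of_nonneg hs hs0
  set x := c 1
  have hM : 0 < ‖x‖ := norm_pos_iff.2 hx0
  obtain ⟨l, hl, f, hf, -, hnorm⟩ := hα.exists_net (s := ‖x‖⁻¹ • x) (smul_nonneg (by positivity) hx)
    (by rw [norm_smul, norm_inv, norm_norm, inv_mul_cancel₀ hM.ne'])
  have hn : (0 : ℝ) < Fintype.card G := by exact_mod_cast Fintype.card_pos
  -- The sum of the f_g x f_g will have norm above (3/4 - 1/4)‖x‖, so one of them has norm above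
  -- ‖x‖/(2|G|) = 2δ and survives the cut-down by δ.
  set δ : ℝ := ‖x‖ / (4 * Fintype.card G)
  have hδ : 0 < δ := by positivity
  have h1 := hnorm (1 / 4) (by norm_num)
  have h2 := (hf.compress_asympEq x).eventually_norm_sub_lt (show 0 < ‖x‖ / 4 by positivity)
  have h3 : ∀ᶠ i in l, ∀ g, ‖π (f i g) * s * π (f i g) - π (f i g * x * f i g)‖ < δ := by
    rw [eventually_all]
    intro g
    have := (hf.map_compress_asympEq hu c g).eventually_norm_sub_lt hδ
    rwa [← hc] at this
  obtain ⟨i, h4, h5, h6⟩ := (h1.and (h2.and h3)).exists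
  have hsa : ∀ g, star (f i g) = f i g := fun g => (IsSelfAdjoint.of_nonneg (hf.nonneg i g)).star_eq
  have h7 : 3 / 4 * ‖x‖ < ‖(∑ g, f i g) * x * ∑ g, f i g‖ := by
    rw [mul_smul_comm, smul_mul_assoc, norm_smul, norm_inv, norm_norm, inv_mul_eq_div,
      lt_div_iff₀ hM] at h4
    linarith
  have h8 : ∑ _g : G, ‖x‖ / (2 * Fintype.card G) < ∑ g, ‖f i g * x * f i g‖ := by
    have h9 : ∑ _g : G, ‖x‖ / (2 * Fintype.card G) = ‖x‖ / 2 := by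
      rw [Finset.sum_const, Finset.card_univ, nsmul_eq_mul]; field_simp
    have h10 := norm_sum_le Finset.univ fun g => f i g * x * f i g
    have h11 := norm_sub_norm_le ((∑ g, f i g) * x * ∑ g, f i g) (∑ g, f i g * x * f i g)
    rw [h9]
    linarith
  obtain ⟨g, -, hg⟩ := Finset.exists_lt_of_sum_lt h8
  set y := f i g * x * f i g
  have hy0 : 0 ≤ y := by
    have := star_left_conjugate_nonneg hx (f i g)
    rwa [hsa] at this
  have hy : IsSelfAdjoint (y - algebraMap ℝ A δ) :=
    (IsSelfAdjoint.of_nonneg hy0).sub (IsSelfAdjoint.algebraMap A (IsSelfAdjoint.all δ))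
  have hp : IsSelfAdjoint (y - algebraMap ℝ A δ)⁺ := IsSelfAdjoint.of_nonneg (CFC.posPart_nonneg _)
  have hb : 0 ≤ π (f i g) * s * π (f i g) := by
    have := star_left_conjugate_nonneg hs (π (f i g))
    rwa [← map_star, hsa] at this
  refine ⟨(y - algebraMap ℝ A δ)⁺ * (y - algebraMap ℝ A δ)⁺, ?_, ?_, ?_⟩
  · simpa [hp.star_eq] using star_mul_self_nonneg (y - algebraMap ℝ A δ)⁺
  · intro h
    nth_rw 1 [← hp.star_eq] at h
    rw [CStarRing.star_mul_self_eq_zero_iff, CFC.posPart_eq_zero_iff _ hy, sub_nonpos] at h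
    have h9 := (CStarAlgebra.norm_le_iff_le_algebraMap y hδ.le hy0).2 h
    have h10 : δ < ‖x‖ / (2 * Fintype.card G) := by
      rw [div_lt_div_iff_of_pos_left hM (by positivity) (by positivity)]; linarith
    linarith
  · rw [map_mul, map_posPart_sub π (IsSelfAdjoint.of_nonneg hy0)]
    refine (cuntzLE_posPart_mul_self ((IsSelfAdjoint.of_nonneg hy0).map π)
      (IsSelfAdjoint.of_nonneg hb) ?_).trans ?_
    · rw [norm_sub_rev]
      exact (h6 g).le
    · have := cuntzLE_star_mul_mul s (π (f i g))
      rwa [← map_star, hsa] at this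

/-- A nonzero closed ideal contains some x*x ≠ 0, hence a nonzero π(t) Cuntz below it. Its preimage
in A is then a nonzero closed ideal, so it contains 1. -/
theorem IsSimpleCStar.of_isCovariantSpan (hA : IsSimpleCStar A) (hα : WeakTracialRokhlin α)
    (hu : IsCovariantSpan α π u) : IsSimpleCStar E := by
  have := hA.1
  refine ⟨hu.injective.nontrivial, fun I hI => or_iff_not_imp_left.2 fun hI0 => ?_⟩
  obtain ⟨x, hxI, hx0⟩ : ∃ x ∈ I, x ≠ 0 := by
    by_contra h
    push Not at h
    exact hI0 (eq_bot_iff.2 fun x hx => by simpa using h x hx)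
  have hs0 : star x * x ≠ 0 := fun h => hx0 (CStarRing.star_mul_self_eq_zero_iff _ |>.1 h)
  have hsI : star x * x ∈ I := I.mul_mem_left _ _ hxI
  obtain ⟨t, -, ht0, z, hz⟩ := exists_map_cuntzLE hα hu (star_mul_self_nonneg x) hs0
  have htI : π t ∈ I := by
    have h1 : Tendsto (fun k => star (z k) * (star x * x) * z k) atTop (𝓝 (π t)) := by
      rw [tendsto_iff_norm_sub_tendsto_zero]
      simpa only [norm_sub_rev] using hz
    exact hI.mem_of_tendsto h1 (Eventually.of_forall fun k =>
      I.mul_mem_right _ _ (I.mul_mem_left _ _ hsI))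
  have hJ : IsClosed (I.comap π : Set A) := by
    have h1 : (I.comap π : Set A) = π ⁻¹' I := by
      ext y; simp [TwoSidedIdeal.mem_comap]
    rw [h1]
    exact hI.preimage (NonUnitalStarAlgHom.isometry π hu.injective).continuous
  have htop := (hA.2 _ hJ).resolve_left fun h => by
    have h1 : t ∈ I.comap π := (TwoSidedIdeal.mem_comap π).2 htI
    rw [h] at h1
    exact ht0 (by simpa using h1)
  have h1 : (1 : A) ∈ I.comap π := by rw [htop]; trivial
  rw [TwoSidedIdeal.mem_comap, map_one] at h1
  exact (TwoSidedIdeal.one_mem_iff I).1 h1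

end RokhlinNet

/-! ### Truncating a positive contraction inside a subalgebra -/

section Truncation

variable {E : Type*} [CStarAlgebra E]

/-- The function is t ↦ min(1, t/(1-κ)). It vanishes at 0, so the non-unital calculus keeps the
result in a closed subalgebra containing p. -/
lemma one_sub_cfcₙ_eq {p : E} (hp : IsSelfAdjoint p) {κ : ℝ} (hκ : κ < 1) :
    1 - cfcₙ (fun t : ℝ => 1 - (1 - κ)⁻¹ * (1 - t - κ)⁺) p
      = (1 - κ)⁻¹ • (1 - p - algebraMap ℝ E κ)⁺ := by
  have h0 : 1 - (1 - κ)⁻¹ * (1 - 0 - κ)⁺ = 0 := by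
    rw [sub_zero, posPart_of_nonneg (sub_pos.2 hκ).le, inv_mul_cancel₀ (sub_pos.2 hκ).ne', sub_self]
  have hc : Continuous fun t : ℝ => (1 - t - κ)⁺ := by fun_prop
  have hc' : Continuous fun t : ℝ => 1 - (1 - κ)⁻¹ * (1 - t - κ)⁺ := by fun_prop
  have h2 : 1 - p - algebraMap ℝ E κ = cfc (fun t : ℝ => 1 - t - κ) p := by
    rw [cfc_sub _ _ p, cfc_sub _ _ p, cfc_id' ℝ p, cfc_const κ p, cfc_const 1 p, map_one]
  have h3 : (1 : E) = cfc (fun _ : ℝ => (1 : ℝ)) p := by rw [cfc_const 1 p, map_one]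
  rw [cfcₙ_eq_cfc hc'.continuousOn h0, h2, posPart_cfc hp (by fun_prop),
    ← cfc_smul _ _ p hc.continuousOn]
  nth_rw 1 [h3]
  rw [← cfc_sub _ _ p (by fun_prop) hc'.continuousOn]
  exact cfc_congr fun t _ => by simp

variable [PartialOrder E] [StarOrderedRing E]

/-- A positive contraction `p` in a closed subalgebra can be perturbed to `d` such that `1 - d` is
Cuntz below any given element close to `1 - p`. -/
lemma exists_cuntzLE_one_sub {B : NonUnitalStarSubalgebra ℂ E} (hB : IsClosed (B : Set E)) {p b : E}
    (hpB : p ∈ B) (hp : 0 ≤ p) (hp1 : ‖p‖ ≤ 1) (hb : IsSelfAdjoint b) {κ : ℝ}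
    (hκ : ‖1 - p - b‖ ≤ κ) (hκ1 : κ < 1) :
    ∃ d ∈ B, 0 ≤ d ∧ ‖d‖ ≤ 1 ∧ ‖d - p‖ ≤ κ ∧ CuntzLE (1 - d) b := by
  have hκ0 : 0 ≤ κ := (norm_nonneg _).trans hκ
  have hδ : 0 < 1 - κ := sub_pos.2 hκ1
  have hps := IsSelfAdjoint.of_nonneg hp
  set h : ℝ → ℝ := fun t => 1 - (1 - κ)⁻¹ * (1 - t - κ)⁺ with hh
  have hcont : Continuous h := by fun_prop
  have hh0 : h 0 = 0 := by
    rw [hh]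
    simp only [sub_zero]
    rw [posPart_of_nonneg hδ.le, inv_mul_cancel₀ hδ.ne', sub_self]
  have hsp : ∀ t ∈ spectrum ℝ p, 0 ≤ t ∧ t ≤ 1 := fun t ht => by
    refine ⟨spectrum_nonneg_of_nonneg hp ht, ?_⟩
    have := norm_apply_le_norm_cfc (fun t : ℝ => t) p ht
    rw [cfc_id' ℝ p] at this
    exact (le_abs_self t).trans (this.trans hp1)
  have hbd : ∀ t : ℝ, 0 ≤ t → t ≤ 1 → t ≤ h t ∧ h t ≤ 1 ∧ h t ≤ t + κ := by
    intro t h0 h1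
    rcases le_total (1 - t - κ) 0 with h2 | h2
    · have : h t = 1 := by rw [hh]; simp only; rw [posPart_of_nonpos h2, mul_zero, sub_zero]
      rw [this]
      exact ⟨h1, le_rfl, by linarith⟩
    · have h3 : h t * (1 - κ) = t := by
        rw [hh]; simp only; rw [posPart_of_nonneg h2]; field_simp; ring
      refine ⟨?_, ?_, ?_⟩ <;> nlinarith
  refine ⟨cfcₙ h p, ?_, ?_, ?_, ?_, ?_⟩
  · have := hB
    exact cfcₙ_mem h hpB
  · rw [cfcₙ_eq_cfc]
    refine cfc_nonneg fun t ht => ?_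
    obtain ⟨h1, h2⟩ := hsp t ht
    exact h1.trans (hbd t h1 h2).1
  · rw [cfcₙ_eq_cfc]
    refine norm_cfc_le zero_le_one fun t ht => ?_
    obtain ⟨h1, h2⟩ := hsp t ht
    obtain ⟨h3, h4, h5⟩ := hbd t h1 h2
    rw [Real.norm_of_nonneg (h1.trans h3)]
    exact h4
  · rw [cfcₙ_eq_cfc]
    nth_rw 2 [← cfc_id' ℝ p]
    rw [← cfc_sub _ _ p]
    refine norm_cfc_le hκ0 fun t ht => ?_
    obtain ⟨h1, h2⟩ := hsp t ht
    obtain ⟨h3, h4, h5⟩ := hbd t h1 h2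
    rw [Real.norm_of_nonneg (sub_nonneg.2 h3)]
    linarith
  · rw [one_sub_cfcₙ_eq hps hκ1]
    exact (cuntzLE_smul (by positivity) _).trans (cuntzLE_posPart
      ((IsSelfAdjoint.one E).sub hps) hb hκ)

end Truncation

/-! ### From approximate towers to exact matrix towers -/

section Tower

variable {A G : Type*} [CStarAlgebra A] [PartialOrder A] [StarOrderedRing A]
  [Group G] [Fintype G] {E : Type*} [CStarAlgebra E]
  {α : G →* (A ≃⋆ₐ[ℂ] A)} {π : A →⋆ₐ[ℂ] E} {u : G → E}

/-- An approximately equivariant tower of orthogonal positive contractions can be perturbed to a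
tower which spans matrices over a hereditary subalgebra of the coefficient algebra. -/
lemma exists_matrix_tower (hu : IsCovariantSpan α π u) {f : G → A} (hf : ∀ g, 0 ≤ f g)
    (hf1 : ∀ g, ‖f g‖ ≤ 1) (horth : ∀ g h, g ≠ h → f g * f h = 0) {η : ℝ}
    (hη : ∀ g, ‖α g (f 1) - f g‖ ≤ η) :
    ∃ (a : A) (ha : 0 ≤ a) (B : NonUnitalStarSubalgebra ℂ E) (c : G → A),
      ‖a‖ ≤ 1 ∧ IsClosed (B : Set E) ∧
      Nonempty (B ≃⋆ₐ[ℂ] CStarMatrix (Fin (Fintype.card G)) (Fin (Fintype.card G))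
        (hereditarySubalgebra a (IsSelfAdjoint.of_nonneg ha))) ∧
      (∀ g h x, π (c g * x * α (g * h⁻¹) (star (c h))) * u (g * h⁻¹) ∈ B) ∧
      (∀ g, ‖c g‖ ≤ 1) ∧ ‖∑ g, c g * star (c g)‖ ≤ 1 ∧
      ∀ g, ‖c g - f g‖ ≤ √(4 * √(2 * η)) + 2 * η := by
  have hη0 : 0 ≤ η := (norm_nonneg _).trans (hη 1)
  have hαpos : ∀ g, 0 ≤ α g (f 1) := fun g => map_nonneg (α g) (hf 1)
  have hαn : ∀ g x, ‖α g x‖ = ‖x‖ := fun g x => StarAlgEquiv.norm_map (α g) x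
  -- The positive elements compared are α_g(f_1) and f_g, so all |c_g| are translates α_g(a) of a
  -- single a.
  choose c hcc hann hclose using fun g => exists_close_polar (hαpos g)
    ((hαn g (f 1)).trans_le (hf1 1)) (hf g) (hη g)
  have ha0 : 0 ≤ (f 1 - algebraMap ℝ A η)⁺ := CFC.posPart_nonneg _
  have hαa : ∀ g, (α g (f 1) - algebraMap ℝ A η)⁺ = α g (f 1 - algebraMap ℝ A η)⁺ := fun g =>
    (map_posPart_sub (α g : A →⋆ₐ[ℂ] A) (IsSelfAdjoint.of_nonneg (hf 1)) η).symm
  have ha1 : ‖(f 1 - algebraMap ℝ A η)⁺‖ ≤ 1 := norm_posPart_sub_algebraMap_le (hf 1) (hf1 1) hη0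
  have hfa := norm_sub_posPart_le (hf 1) hη0
  simp only [hαa] at hcc hclose
  set a := (f 1 - algebraMap ℝ A η)⁺
  -- Whatever kills f_h on the left kills c_h; this is applied first to f_g and then to c_h*.
  have hc0 : ∀ g h, g ≠ h → star (c g) * c h = 0 := by
    intro g h hgh
    have h1 : f g * c h = 0 := hann h _ (horth g h hgh)
    have h2 : star (c h) * f g = 0 := by
      have := congrArg star h1
      rwa [star_mul, star_zero, (IsSelfAdjoint.of_nonneg (hf g)).star_eq] at this
    have h3 : star (c h) * c g = 0 := hann g _ h2
    have := congrArg star h3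
    rwa [star_mul, star_star, star_zero] at this
  have hc1 : ∀ g, ‖c g‖ ≤ 1 := by
    intro g
    have h1 : ‖c g‖ * ‖c g‖ ≤ 1 := by
      rw [← CStarRing.norm_star_mul_self, hcc, ← map_mul, hαn]
      exact (norm_mul_le _ _).trans (mul_le_one₀ ha1 (norm_nonneg _) ha1)
    nlinarith [norm_nonneg (c g)]
  let e : Fin (Fintype.card G) ≃ G := (Fintype.equivFin G).symm
  obtain ⟨B, hB, hiso, hmem⟩ := exists_matrix_subalgebra hu.injective (IsSelfAdjoint.of_nonneg ha0)
    (fun j => π (c (e j)) * u (e j)) (by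
      intro j k
      rw [star_mul, mul_assoc, ← mul_assoc (star (π _)), ← map_star, ← map_mul]
      split_ifs with hjk
      · rw [hjk, hcc, ← map_mul, ← hu.covariant, ← mul_assoc, hu.star_eq, hu.inv_mul, one_mul]
      · rw [hc0 _ _ fun h => hjk (e.injective h), map_zero, zero_mul, mul_zero])
  refine ⟨a, ha0, B, c, ha1, hB, hiso, fun g h x => ?_, hc1, ?_, fun g => ?_⟩
  · have h1 := hmem (e.symm g) (e.symm h) (α g⁻¹ x)
    simp only [Equiv.apply_symm_apply] at h1
    convert h1 using 1
    have h2 : u g * π (α g⁻¹ x) = π x * u g := by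
      rw [hu.covariant, ← StarAlgEquiv.mul_apply, ← map_mul, mul_inv_cancel, map_one]
      rfl
    rw [star_mul, hu.star_eq, ← map_star, mul_assoc (π (c g)) (u g), h2]
    simp only [map_mul π, mul_assoc]
    rw [← hu.covariant, hu.mul, mul_assoc]
  -- By orthogonality the square of the sum is ∑ c_g (c_g* c_g) c_g*, and c_g* c_g ≤ 1.
  · refine norm_le_one_of_mul_self_le (IsSelfAdjoint.of_nonneg
      (Finset.sum_nonneg fun g _ => mul_star_self_nonneg (c g))) ?_
    have h1 : (∑ g, c g * star (c g)) * ∑ g, c g * star (c g)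
        = ∑ g, c g * (star (c g) * c g) * star (c g) := by
      classical
      rw [Finset.sum_mul_sum]
      refine Finset.sum_congr rfl fun g _ => ?_
      rw [Finset.sum_eq_single g]
      · simp only [mul_assoc]
      · intro h _ hh
        rw [mul_assoc, ← mul_assoc (star (c g)), hc0 g h hh.symm, zero_mul, mul_zero]
      · simp
    rw [h1]
    refine Finset.sum_le_sum fun g _ => ?_
    have h2 : star (c g) * c g ≤ 1 := by
      rw [← CStarAlgebra.norm_le_one_iff_of_nonneg _ (star_mul_self_nonneg _),
        CStarRing.norm_star_mul_self]
      exact mul_le_one₀ (hc1 g) (norm_nonneg _) (hc1 g)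
    simpa using star_right_conjugate_le_conjugate h2 (c g)
  · have h1 : ‖c g - α g a‖ ≤ √(4 * √(2 * η)) := Real.le_sqrt_of_sq_le (by rw [sq]; exact hclose g)
    have h2 : ‖α g a - α g (f 1)‖ ≤ η := by
      rw [← map_sub, hαn, norm_sub_rev]; exact hfa
    calc ‖c g - f g‖ = ‖(c g - α g a) + (α g a - α g (f 1)) + (α g (f 1) - f g)‖ := by
          congr 1; abel
      _ ≤ ‖c g - α g a‖ + ‖α g a - α g (f 1)‖ + ‖α g (f 1) - f g‖ := norm_add₃_le
      _ ≤ _ := by linarith [hη g]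

end Tower

/-! ### Assembling the approximation -/

section Assembly

variable {A G : Type*} [CStarAlgebra A] [PartialOrder A] [StarOrderedRing A]
  [Group G] [Fintype G]

namespace IsRokhlinNet

variable {ι : Type*} {α : G →* (A ≃⋆ₐ[ℂ] A)} {l : Filter ι} {f : ι → G → A}

lemma sum_nonneg (hf : IsRokhlinNet α l f) (i : ι) : 0 ≤ ∑ g, f i g :=
  Finset.sum_nonneg fun g _ => hf.nonneg i g

lemma sum_mul_sum (hf : IsRokhlinNet α l f) (i : ι) :
    (∑ g, f i g) * ∑ g, f i g = ∑ g, f i g * f i g := by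
  classical
  rw [Finset.sum_mul_sum]
  refine Finset.sum_congr rfl fun g _ => Finset.sum_eq_single g (fun h _ hh => ?_) (by simp)
  exact hf.orthogonal i g h hh.symm

lemma norm_sum_le_one (hf : IsRokhlinNet α l f) (i : ι) : ‖∑ g, f i g‖ ≤ 1 := by
  refine norm_le_one_of_mul_self_le (IsSelfAdjoint.of_nonneg (hf.sum_nonneg i)) ?_
  rw [hf.sum_mul_sum]
  exact Finset.sum_le_sum fun g _ => mul_self_le_self_of_norm_le_one (hf.nonneg i g)
    (hf.norm_le_one i g)

/-- Each α_h asymptotically permutes the tower by left translation. -/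
lemma map_sum_asympEq (hf : IsRokhlinNet α l f) (h : G) :
    AsympEq l (fun i => α h (∑ g, f i g)) fun i => ∑ g, f i g := by
  have h1 : AsympEq l (fun i => ∑ g, α h (f i g)) fun i => ∑ g, f i (h * g) :=
    AsympEq.sum fun g _ => hf.equivariant h g
  exact h1.congr (fun i => (map_sum _ _ _).symm) fun i => Equiv.sum_comp (Equiv.mulLeft h) (f i)

variable {E : Type*} [CStarAlgebra E] {π : A →⋆ₐ[ℂ] E} {u : G → E}

/-- The sum of the Rokhlin towers is asymptotically central in the crossed product. -/
lemma map_sum_comm (hf : IsRokhlinNet α l f) (hu : IsCovariantSpan α π u) (x : E) :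
    AsympEq l (fun i => π (∑ g, f i g) * x) fun i => x * π (∑ g, f i g) := by
  obtain ⟨c, rfl⟩ := hu.exists_sum x
  have h1 : AsympEq l (fun i => ∑ h, π ((∑ g, f i g) * c h) * u h)
      fun i => ∑ h, π (c h * α h (∑ g, f i g)) * u h := by
    refine AsympEq.sum fun h _ => AsympEq.mul_right ?_ (.const _)
    refine AsympEq.map (X := fun i => (∑ g, f i g) * c h)
      (Y := fun i => c h * α h (∑ g, f i g)) ?_ π fun y => (hu.norm_map y).le
    have h2 : AsympEq l (fun i => (∑ g, f i g) * c h) fun i => c h * ∑ g, f i g :=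
      (AsympEq.sum fun g _ => hf.comm (c h) g).congr (fun i => (Finset.sum_mul _ _ _).symm)
        fun i => (Finset.mul_sum _ _ _).symm
    exact h2.trans ((hf.map_sum_asympEq h).symm.mul_left (.const _))
  refine h1.congr (fun i => ?_) fun i => ?_
  · rw [Finset.mul_sum]
    simp only [map_mul, mul_assoc]
  · rw [Finset.sum_mul]
    simp only [map_mul, mul_assoc, hu.covariant]

end IsRokhlinNet

variable {E : Type*} [CStarAlgebra E] [PartialOrder E] [StarOrderedRing E]
  {α : G →* (A ≃⋆ₐ[ℂ] A)} {π : A →⋆ₐ[ℂ] E} {u : G → E}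

theorem exists_matrix_approximation (hA : IsSimpleCStar A) (hα : WeakTracialRokhlin α)
    (hu : IsCovariantSpan α π u) (F : Finset E) {ε : ℝ} (hε : 0 < ε) {s : E} (hs : 0 ≤ s)
    (hs0 : s ≠ 0) :
    ∃ (a : A) (ha : 0 ≤ a) (B : NonUnitalStarSubalgebra ℂ E) (d : E),
      ‖a‖ ≤ 1 ∧
      IsClosed (B : Set E) ∧
      Nonempty (B ≃⋆ₐ[ℂ] CStarMatrix (Fin (Fintype.card G)) (Fin (Fintype.card G))
        (hereditarySubalgebra a (IsSelfAdjoint.of_nonneg ha))) ∧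
      d ∈ B ∧ 0 ≤ d ∧ ‖d‖ ≤ 1 ∧
      (∀ x ∈ F, ‖d * x - x * d‖ < ε) ∧
      (∀ x ∈ F, ∃ b ∈ B, ‖d * x - b‖ < ε) ∧
      CuntzLE (1 - d) s ∧
      (∀ x ∈ F, ‖x‖ - ε < ‖d * x * d‖) := by
  classical
  have hE : IsSimpleCStar E := hA.of_isCovariantSpan hα hu
  obtain ⟨t, ht, ht0, hts⟩ := exists_map_cuntzLE hα hu hs hs0
  have htn : 0 < ‖t‖ := norm_pos_iff.2 ht0
  obtain ⟨l, hl, f, hf, hcuntz, hnorm⟩ := hα.exists_net (s := ‖t‖⁻¹ • t)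
    (smul_nonneg (by positivity) ht)
    (by rw [norm_smul, norm_inv, norm_norm, inv_mul_cancel₀ htn.ne'])
  -- the perturbed towers
  set η : Finset A × ℕ → ℝ := fun i => ∑ g, ‖α g (f i 1) - f i g‖
  have hη : Tendsto η l (𝓝 0) := by
    rw [← Finset.sum_const_zero (s := (Finset.univ : Finset G))]
    refine tendsto_finsetSum _ fun g _ => tendsto_zero_iff_norm_tendsto_zero.1 ?_
    simpa [AsympEq] using hf.equivariant g 1
  choose a ha B c ha1 hB hiso hmem hc1 hcsum hclose using fun i =>
    exists_matrix_tower hu (hf.nonneg i) (hf.norm_le_one i) (hf.orthogonal i) (η := η i)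
      fun g => Finset.single_le_sum (f := fun g => ‖α g (f i 1) - f i g‖)
        (fun _ _ => norm_nonneg _) (Finset.mem_univ g)
  have hcb : ∀ g, NormBounded fun i => c i g := fun g => ⟨1, fun i => hc1 i g⟩
  have hcf : ∀ g, AsympEq l (fun i => c i g) fun i => f i g := by
    intro g
    have h1 : Tendsto (fun i => √(4 * √(2 * η i)) + 2 * η i) l (𝓝 (√(4 * √(2 * 0)) + 2 * 0)) :=
      (((hη.const_mul 2).sqrt.const_mul 4).sqrt).add (hη.const_mul 2)
    simp only [mul_zero, Real.sqrt_zero, add_zero] at h1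
    exact squeeze_zero_norm (fun i => hclose i g) h1
  have hfsa : ∀ i g, star (f i g) = f i g := fun i g =>
    (IsSelfAdjoint.of_nonneg (hf.nonneg i g)).star_eq
  have hcf' : ∀ g, AsympEq l (fun i => star (c i g)) fun i => f i g := fun g =>
    (hcf g).star_star.congr (fun _ => rfl) fun i => hfsa i g
  have hcb' : ∀ g, NormBounded fun i => star (c i g) := fun g =>
    ⟨1, fun i => (norm_star _).trans_le (hc1 i g)⟩
  set e : Finset A × ℕ → E := fun i => π (∑ g, f i g) with he
  have he0 : ∀ i, 0 ≤ e i := fun i => map_nonneg π (hf.sum_nonneg i)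
  have he1 : ∀ i, ‖e i‖ ≤ 1 := fun i => (hu.norm_map _).trans_le (hf.norm_sum_le_one i)
  have hesa : ∀ i, star (e i) = e i := fun i => (IsSelfAdjoint.of_nonneg (he0 i)).star_eq
  have hecomm : ∀ x : E, AsympEq l (fun i => e i * x) fun i => x * e i := hf.map_sum_comm hu
  have heb : NormBounded e := ⟨1, he1⟩
  have heb2 : NormBounded fun i => e i * e i := heb.mul heb
  have hee : ∀ i, e i * e i = π (∑ g, f i g * f i g) := fun i => by
    rw [he, ← map_mul, hf.sum_mul_sum]
  -- The norm clause of the Rokhlin property, for t/‖t‖, is used only here: ‖f (t/‖t‖) f‖ ≤ ‖f‖.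
  have hone : Tendsto (fun i => ‖e i‖) l (𝓝 1) := by
    have h1 : ∀ i, ‖(∑ g, f i g) * (‖t‖⁻¹ • t) * ∑ g, f i g‖ ≤ ‖e i‖ := by
      intro i
      rw [he, hu.norm_map]
      have h2 : ‖‖t‖⁻¹ • t‖ = 1 := by
        rw [norm_smul, norm_inv, norm_norm, inv_mul_cancel₀ htn.ne']
      calc _ ≤ ‖∑ g, f i g‖ * ‖‖t‖⁻¹ • t‖ * ‖∑ g, f i g‖ :=
            (norm_mul_le _ _).trans (by gcongr; exact norm_mul_le _ _)
        _ ≤ 1 * 1 * ‖∑ g, f i g‖ := by gcongr; exacts [hf.norm_sum_le_one i, h2.le]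
        _ = _ := by ring
    refine tendsto_order.2 ⟨fun r hr => ?_, fun r hr => Eventually.of_forall fun i =>
      (he1 i).trans_lt hr⟩
    filter_upwards [hnorm (1 - r) (sub_pos.2 hr)] with i hi
    linarith [h1 i]
  -- the approximate unit of the matrix subalgebra
  set p : Finset A × ℕ → E := fun i => π (∑ g, c i g * star (c i g))
  have hpe : AsympEq l p fun i => e i * e i := by
    have h1 : AsympEq l (fun i => ∑ g, c i g * star (c i g)) fun i => ∑ g, f i g * f i g :=
      AsympEq.sum fun g _ => (hcf g).mul (hcf' g) (hcb' g) (hf.normBounded g)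
    exact (h1.map π fun y => (hu.norm_map y).le).congr (fun _ => rfl) fun i => (hee i).symm
  have hp0 : ∀ i, 0 ≤ p i := fun i =>
    map_nonneg π (Finset.sum_nonneg fun g _ => mul_star_self_nonneg (c i g))
  have hp1 : ∀ i, ‖p i‖ ≤ 1 := fun i => (hu.norm_map _).trans_le (hcsum i)
  have hpB : ∀ i, p i ∈ B i := by
    intro i
    simp only [p, map_sum]
    refine sum_mem fun g _ => ?_
    have := hmem i g g 1
    rwa [mul_one, mul_inv_cancel, hu.one, mul_one, map_one α] at this
  have hd : ∀ i, ∃ d ∈ B i, 0 ≤ d ∧ ‖d‖ ≤ 1 ∧ ‖d - p i‖ ≤ ‖p i - e i * e i‖ ∧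
      (‖p i - e i * e i‖ < 1 → CuntzLE (1 - d) (1 - e i * e i)) := by
    intro i
    rcases lt_or_ge ‖p i - e i * e i‖ 1 with h | h
    · have hb : IsSelfAdjoint (1 - e i * e i) :=
        (IsSelfAdjoint.one E).sub (by rw [IsSelfAdjoint, star_mul, hesa])
      obtain ⟨d, h1, h2, h3, h4, h5⟩ := exists_cuntzLE_one_sub (hB i) (hpB i) (hp0 i) (hp1 i) hb
        (κ := ‖p i - e i * e i‖) (by rw [sub_sub_sub_cancel_left, norm_sub_rev]) h
      exact ⟨d, h1, h2, h3, h4, fun _ => h5⟩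
    · exact ⟨p i, hpB i, hp0 i, hp1 i, by simp, fun h' => absurd h' (not_lt.2 h)⟩
  choose d hdB hd0 hd1 hdp hdc using hd
  have hde : AsympEq l d fun i => e i * e i :=
    AsympEq.trans (squeeze_zero_norm hdp (tendsto_zero_iff_norm_tendsto_zero.1 hpe)) hpe
  have hdb : NormBounded d := ⟨1, hd1⟩
  have hee_comm : ∀ x : E, AsympEq l (fun i => e i * e i * x) fun i => x * (e i * e i) := by
    intro x
    exact (asympEq_pow_mul_comm he1 hecomm 2 x).congr (fun i => by rw [sq]) fun i => by rw [sq]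
  -- the four asymptotic properties
  have hcomm : ∀ x : E, AsympEq l (fun i => d i * x) fun i => x * d i := fun x =>
    (hde.mul_right (.const x)).trans ((hee_comm x).trans (hde.symm.mul_left (.const x)))
  have happrox : ∀ x : E, ∃ b : Finset A × ℕ → E, (∀ i, b i ∈ B i) ∧
      AsympEq l (fun i => d i * x) b := by
    intro x
    obtain ⟨y, rfl⟩ := hu.exists_sum x
    refine ⟨fun i => ∑ h, ∑ g, π (c i g * y h * α h (star (c i (h⁻¹ * g)))) * u h, fun i => ?_, ?_⟩
    · refine sum_mem fun h _ => sum_mem fun g _ => ?_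
      have := hmem i g (h⁻¹ * g) (y h)
      rwa [mul_inv_rev, inv_inv, mul_inv_cancel_left] at this
    · refine (hde.mul_right (.const _)).trans (AsympEq.symm ?_)
      -- The index h⁻¹g is chosen so that α_h(c*_{h⁻¹g}) ≈ α_h(f_{h⁻¹g}) ≈ f_g; then f_g is moved
      -- past y_h.
      have h1 : ∀ h g, AsympEq l (fun i => c i g * y h * α h (star (c i (h⁻¹ * g))))
          fun i => f i g * f i g * y h := by
        intro h g
        have h2 : AsympEq l (fun i => α h (star (c i (h⁻¹ * g)))) fun i => f i g := by
          have h3 := (hcf' (h⁻¹ * g)).map (α h) fun z => (StarAlgEquiv.norm_map (α h) z).le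
          exact h3.trans ((hf.equivariant h (h⁻¹ * g)).congr (fun _ => rfl)
            fun i => by rw [mul_inv_cancel_left])
        have hb : NormBounded fun i => α h (star (c i (h⁻¹ * g))) :=
          ⟨1, fun i => (StarAlgEquiv.norm_map (α h) _).trans_le
            ((norm_star _).trans_le (hc1 i _))⟩
        have h4 := ((hcf g).mul_right (NormBounded.const (y h))).mul h2 hb
          ((hf.normBounded g).mul (.const _))
        have h5 := ((hf.comm (y h) g).symm).mul_left (hf.normBounded g)
        exact h4.trans (h5.congr (fun i => (mul_assoc _ _ _).symm) fun i => (mul_assoc _ _ _).symm)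
      have h6 : AsympEq l (fun i => ∑ h, ∑ g, π (c i g * y h * α h (star (c i (h⁻¹ * g)))) * u h)
          fun i => ∑ h, ∑ g, π (f i g * f i g * y h) * u h :=
        AsympEq.sum fun h _ => AsympEq.sum fun g _ =>
          ((h1 h g).map π fun z => (hu.norm_map z).le).mul_right (.const _)
      refine h6.congr (fun _ => rfl) fun i => ?_
      rw [hee, Finset.mul_sum]
      refine Finset.sum_congr rfl fun h _ => ?_
      simp only [map_sum, map_mul, Finset.sum_mul, mul_assoc]
  have hcuntz_le : ∀ i, CuntzLE (1 - e i * e i) s := by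
    intro i
    -- The difference 2(1 - e) - (1 - e²) equals (1 - e)².
    have h1 : CuntzLE (1 - e i * e i) ((2 : ℝ) • (1 - e i)) := by
      refine cuntzLE_of_le ?_ ?_
      · rw [sub_nonneg, ← CStarAlgebra.norm_le_one_iff_of_nonneg _
          (by simpa [hesa] using star_mul_self_nonneg (e i))]
        exact (norm_mul_le _ _).trans (mul_le_one₀ (he1 i) (norm_nonneg _) (he1 i))
      · have h2 : (2 : ℝ) • (1 - e i) - (1 - e i * e i) = star (1 - e i) * (1 - e i) := by
          rw [star_sub, star_one, hesa, two_smul]; noncomm_ring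
        rw [← sub_nonneg, h2]
        exact star_mul_self_nonneg _
    have h3 : CuntzLE (1 - e i) (π t) := by
      have := ((hcuntz i).trans (cuntzLE_smul (by positivity) t)).map π
      rwa [map_sub, map_one] at this
    exact (h1.trans (cuntzLE_smul zero_le_two _)).trans (h3.trans hts)
  have hlow : ∀ x : E, ∀ᶠ i in l, ‖x‖ - ε < ‖d i * x * d i‖ := by
    intro x
    -- Since d ≈ e² is asymptotically central, dxd ≈ e⁴x; the powers e⁴ are again asymptotically
    -- central positive contractions with norms tending to 1.
    have h4 : ∀ i, e i ^ 4 = star (e i * e i) * (e i * e i) := fun i => by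
      rw [star_mul, hesa, pow_succ, pow_succ, sq]; simp only [mul_assoc]
    have h1 := eventually_norm_sub_lt_norm_mul (e := fun i => e i ^ 4) (l := l) hE
      (fun i => by rw [h4]; exact star_mul_self_nonneg _)
      (fun i => by
        have := hE.1
        exact (norm_pow_le _ _).trans (pow_le_one₀ (norm_nonneg _) (he1 i)))
      (fun x => asympEq_pow_mul_comm he1 hecomm 4 x)
      (by
        have h2 : ∀ i, ‖e i ^ 4‖ = ‖e i‖ ^ 4 := fun i =>
          IsSelfAdjoint.norm_pow_two_pow (IsSelfAdjoint.of_nonneg (he0 i)) 2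
        simpa [h2] using hone.pow 4) x (half_pos hε)
    have h2 : AsympEq l (fun i => d i * x * d i) fun i => e i ^ 4 * x := by
      have h3 := (hde.mul_right (.const x)).mul hde hdb (heb2.mul (.const x))
      have h5 := (hee_comm x).symm.mul_left heb2
      exact h3.trans (h5.congr (fun i => (mul_assoc _ _ _).symm)
        fun i => by rw [h4, star_mul, hesa]; simp only [mul_assoc])
    filter_upwards [h1, h2.eventually_norm_sub_lt (half_pos hε)] with i h6 h7
    have h8 := norm_sub_norm_le (e i ^ 4 * x) (d i * x * d i)
    rw [norm_sub_rev] at h8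
    linarith
  choose b hbB hb using happrox
  have hev : ∀ᶠ i in l, (∀ x ∈ F, ‖d i * x - x * d i‖ < ε) ∧ (∀ x ∈ F, ‖d i * x - b x i‖ < ε) ∧
      (∀ x ∈ F, ‖x‖ - ε < ‖d i * x * d i‖) ∧ ‖p i - e i * e i‖ < 1 := by
    refine ((F.eventually_all).2 fun x _ => (hcomm x).eventually_norm_sub_lt hε).and
      (((F.eventually_all).2 fun x _ => (hb x).eventually_norm_sub_lt hε).and
      (((F.eventually_all).2 fun x _ => hlow x).and (hpe.eventually_norm_sub_lt one_pos)))
  obtain ⟨i, h1, h2, h3, h4⟩ := hev.exists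
  exact ⟨a i, ha i, B i, d i, ha1 i, hB i, hiso i, hdB i, hd0 i, hd1 i, h1,
    fun x hx => ⟨b x i, hbB x i, h2 x hx⟩, (hdc i h4).trans (hcuntz_le i), h3⟩

end Assembly

/-! ### The regular crossed product as a covariant span -/

section Concrete

variable {A G : Type*} [CStarAlgebra A] [PartialOrder A] [StarOrderedRing A]
  [Group G] [Fintype G] [DecidableEq G]

lemma regularRep_apply (α : G →* (A ≃⋆ₐ[ℂ] A)) (a : A) (h k : G) :
    regularRep α a h k = if h = k then α h⁻¹ a else 0 :=
  Matrix.diagonal_apply _ _ _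

lemma translationUnitary_apply (g h k : G) :
    translationUnitary A g h k = if h = g * k then 1 else 0 := rfl

lemma regularRep_mul_apply (α : G →* (A ≃⋆ₐ[ℂ] A)) (a : A) (M : CStarMatrix G G A) (h k : G) :
    (regularRep α a * M) h k = α h⁻¹ a * M h k := by
  simp [CStarMatrix.mul_apply, regularRep_apply]

lemma translationUnitary_mul_apply (g : G) (M : CStarMatrix G G A) (h k : G) :
    (translationUnitary A g * M) h k = M (g⁻¹ * h) k := by
  rw [CStarMatrix.mul_apply, Finset.sum_eq_single (g⁻¹ * h)]
  · simp [translationUnitary_apply]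
  · intro j _ hj
    rw [translationUnitary_apply, if_neg, zero_mul]
    rintro rfl
    simp at hj
  · simp

/-- The regular representation as a homomorphism of C*-algebras. -/
def regularRepHom (α : G →* (A ≃⋆ₐ[ℂ] A)) : A →⋆ₐ[ℂ] CStarMatrix G G A where
  toFun := regularRep α
  map_one' := by
    ext h k
    simp [regularRep_apply, CStarMatrix.one_apply]
  map_mul' a b := by
    ext h k
    rw [regularRep_mul_apply]
    simp [regularRep_apply]
  map_zero' := by
    ext h k
    simp [regularRep_apply]
  map_add' a b := by
    ext h k
    simp only [CStarMatrix.add_apply, regularRep_apply]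
    split_ifs <;> simp
  commutes' c := by
    ext h k
    rw [regularRep_apply, CStarMatrix.algebraMap_apply, Algebra.algebraMap_eq_smul_one, map_smul,
      map_one]
  map_star' a := by
    ext h k
    rw [CStarMatrix.star_apply, regularRep_apply, regularRep_apply]
    by_cases hk : h = k
    · simp [hk, map_star]
    · simp [hk, Ne.symm hk]

lemma translationUnitary_one : translationUnitary A (1 : G) = 1 := by
  ext h k
  simp [translationUnitary_apply, CStarMatrix.one_apply]

lemma translationUnitary_mul (g h : G) :
    translationUnitary A (g * h) = translationUnitary A g * translationUnitary A h := by
  ext j k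
  rw [translationUnitary_mul_apply, translationUnitary_apply, translationUnitary_apply]
  congr 1
  rw [inv_mul_eq_iff_eq_mul, mul_assoc]

lemma star_translationUnitary (g : G) :
    star (translationUnitary A g) = translationUnitary A g⁻¹ := by
  ext j k
  rw [CStarMatrix.star_apply, translationUnitary_apply, translationUnitary_apply]
  by_cases h : k = g * j
  · rw [if_pos h, if_pos (by rw [h, inv_mul_cancel_left]), star_one]
  · rw [if_neg h, if_neg (fun h' => h (by rw [h', mul_inv_cancel_left])), star_zero]

lemma translationUnitary_mul_regularRep (α : G →* (A ≃⋆ₐ[ℂ] A)) (g : G) (a : A) :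
    translationUnitary A g * regularRep α a = regularRep α (α g a) * translationUnitary A g := by
  ext j k
  rw [translationUnitary_mul_apply, regularRep_mul_apply, regularRep_apply, translationUnitary_apply]
  by_cases h : g⁻¹ * j = k
  · rw [if_pos h, if_pos (by rw [← h, mul_inv_cancel_left]), mul_one, mul_inv_rev, inv_inv, map_mul]
    rfl
  · rw [if_neg h, if_neg (fun h' => h (by rw [h', inv_mul_cancel_left])), mul_zero]

lemma regularRep_injective (α : G →* (A ≃⋆ₐ[ℂ] A)) : Function.Injective (regularRep α) := by
  intro a b hab
  have := congrFun (congrFun hab 1) 1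
  simpa [regularRep_apply] using this

lemma sum_regularRep_mul_apply (α : G →* (A ≃⋆ₐ[ℂ] A)) (c : G → A) (h k : G) :
    (∑ g, regularRep α (c g) * translationUnitary A g) h k = α h⁻¹ (c (h * k⁻¹)) := by
  let φ : CStarMatrix G G A →+ A :=
    { toFun := fun M => M h k, map_zero' := rfl, map_add' := fun _ _ => rfl }
  refine (map_sum φ _ _).trans ?_
  rw [Finset.sum_eq_single (h * k⁻¹)]
  · show (regularRep α (c (h * k⁻¹)) * translationUnitary A (h * k⁻¹) : CStarMatrix G G A) h k = _
    rw [regularRep_mul_apply, translationUnitary_apply, inv_mul_cancel_right, if_pos rfl, mul_one]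
  · intro g _ hg
    show (regularRep α (c g) * translationUnitary A g : CStarMatrix G G A) h k = _
    rw [regularRep_mul_apply, translationUnitary_apply, if_neg, mul_zero]
    rintro rfl
    simp at hg
  · simp

/-- Matrices in the regular crossed product are equivariant. -/
lemma apply_mul_mul_of_mem (α : G →* (A ≃⋆ₐ[ℂ] A)) {M : CStarMatrix G G A}
    (hM : M ∈ regularCrossedProduct α) (g h k : G) : M (h * g) (k * g) = α g⁻¹ (M h k) := by
  have hentry : ∀ h k, Continuous fun M : CStarMatrix G G A => M h k := fun h k =>
    (continuous_apply k).comp (continuous_apply h)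
  have hclosed : IsClosed {M : CStarMatrix G G A | ∀ g h k, M (h * g) (k * g) = α g⁻¹ (M h k)} := by
    simp only [Set.ofPred_forall]
    refine isClosed_iInter fun g => isClosed_iInter fun h => isClosed_iInter fun k =>
      isClosed_eq (hentry _ _) ?_
    exact (StarAlgEquiv.isometry (α g⁻¹)).continuous.comp (hentry h k)
  refine closure_minimal (t := {M | ∀ g h k, M (h * g) (k * g) = α g⁻¹ (M h k)}) ?_ hclosed hM g h k
  intro N hN
  induction hN using StarAlgebra.adjoin_induction with
  | mem x hx =>
    intro g h k
    rcases hx with ⟨a, rfl⟩ | ⟨j, rfl⟩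
    · simp only [regularRep_apply, mul_left_inj, mul_inv_rev, map_mul]
      split_ifs
      · rfl
      · rw [map_zero]
    · simp only [translationUnitary_apply, ← mul_assoc, mul_left_inj]
      split_ifs
      · rw [map_one]
      · rw [map_zero]
  | algebraMap r =>
    intro g h k
    simp only [CStarMatrix.algebraMap_apply, mul_left_inj]
    split_ifs
    · rw [Algebra.algebraMap_eq_smul_one, map_smul, map_one]
    · rw [map_zero]
  | add x y hx hy hx' hy' =>
    intro g h k
    rw [CStarMatrix.add_apply, CStarMatrix.add_apply, hx', hy', map_add]
  | mul x y hx hy hx' hy' =>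
    intro g h k
    rw [CStarMatrix.mul_apply, CStarMatrix.mul_apply, map_sum, ← Equiv.sum_comp (Equiv.mulRight g)]
    refine Finset.sum_congr rfl fun j _ => ?_
    rw [Equiv.coe_mulRight, hx', hy', map_mul]
  | star x hx hx' =>
    intro g h k
    rw [CStarMatrix.star_apply, CStarMatrix.star_apply, hx', map_star]

/-- Equivariance survives norm limits and determines a matrix by its row at the identity, so the
finite sums already exhaust the closure. -/
lemma exists_sum_of_mem (α : G →* (A ≃⋆ₐ[ℂ] A)) {M : CStarMatrix G G A}
    (hM : M ∈ regularCrossedProduct α) :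
    ∃ c : G → A, M = ∑ g, regularRep α (c g) * translationUnitary A g := by
  refine ⟨fun g => M 1 g⁻¹, ?_⟩
  ext h k
  have h1 := apply_mul_mul_of_mem α hM h 1 (k * h⁻¹)
  rw [one_mul, inv_mul_cancel_right] at h1
  rw [sum_regularRep_mul_apply, h1, mul_inv_rev, inv_inv]

lemma regularRep_mem (α : G →* (A ≃⋆ₐ[ℂ] A)) (a : A) : regularRep α a ∈ regularCrossedProduct α :=
  StarSubalgebra.le_topologicalClosure _ (StarAlgebra.subset_adjoin _ _ (Or.inl ⟨a, rfl⟩))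

lemma translationUnitary_mem (α : G →* (A ≃⋆ₐ[ℂ] A)) (g : G) :
    translationUnitary A g ∈ regularCrossedProduct α :=
  StarSubalgebra.le_topologicalClosure _ (StarAlgebra.subset_adjoin _ _ (Or.inr ⟨g, rfl⟩))

/-- The canonical embedding of the coefficient algebra into the crossed product. -/
noncomputable def CrossedProduct.coeffHom (α : G →* (A ≃⋆ₐ[ℂ] A)) : A →⋆ₐ[ℂ] CrossedProduct α :=
  StarAlgHom.codRestrict (regularRepHom α) (regularCrossedProduct α) (regularRep_mem α)

/-- The canonical unitaries of the crossed product. -/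
noncomputable def CrossedProduct.unitary (α : G →* (A ≃⋆ₐ[ℂ] A)) (g : G) : CrossedProduct α :=
  (⟨translationUnitary A g, translationUnitary_mem α g⟩ : regularCrossedProduct α)

theorem CrossedProduct.isCovariantSpan (α : G →* (A ≃⋆ₐ[ℂ] A)) :
    IsCovariantSpan α (CrossedProduct.coeffHom α) (CrossedProduct.unitary α) where
  injective a b hab := regularRep_injective α (congrArg Subtype.val hab)
  one := Subtype.ext translationUnitary_one
  mul g h := Subtype.ext (translationUnitary_mul g h)
  star_eq g := Subtype.ext (star_translationUnitary g)
  covariant g a := Subtype.ext (translationUnitary_mul_regularRep α g a)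
  exists_sum x := by
    obtain ⟨c, hc⟩ := exists_sum_of_mem α x.2
    refine ⟨c, Subtype.ext (hc.trans ?_)⟩
    let φ : CrossedProduct α →+ CStarMatrix G G A :=
      { toFun := Subtype.val, map_zero' := rfl, map_add' := fun _ _ => rfl }
    have hφ : ∀ g, φ (CrossedProduct.coeffHom α (c g) * CrossedProduct.unitary α g) =
        regularRep α (c g) * translationUnitary A g := fun _ => rfl
    exact (Finset.sum_congr rfl fun g _ => (hφ g).symm).trans (map_sum φ _ _).symm

end Concrete

theorem theorem3p4 {A G : Type*} [CStarAlgebra A] [PartialOrder A] [StarOrderedRing A]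
    [Group G] [Fintype G] [DecidableEq G]
    (hdim : ¬ FiniteDimensional ℂ A) (hsimple : IsSimpleCStar A)
    (α : G →* (A ≃⋆ₐ[ℂ] A)) (hα : WeakTracialRokhlin α)
    (F : Finset (CrossedProduct α)) (ε : ℝ) (hε : 0 < ε)
    (s : CrossedProduct α) (hs : 0 ≤ s) (hs0 : s ≠ 0) :
    ∃ (a : A) (ha : 0 ≤ a) (B : NonUnitalStarSubalgebra ℂ (CrossedProduct α))
      (d : CrossedProduct α),
      ‖a‖ ≤ 1 ∧
      IsClosed (B : Set (CrossedProduct α)) ∧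
      Nonempty (B ≃⋆ₐ[ℂ] CStarMatrix (Fin (Fintype.card G)) (Fin (Fintype.card G))
        (hereditarySubalgebra a (IsSelfAdjoint.of_nonneg ha))) ∧
      d ∈ B ∧ 0 ≤ d ∧ ‖d‖ ≤ 1 ∧
      (∀ x ∈ F, ‖d * x - x * d‖ < ε) ∧
      (∀ x ∈ F, ∃ b ∈ B, ‖d * x - b‖ < ε) ∧
      CuntzLE (1 - d) s ∧
      (∀ x ∈ F, ‖x‖ - ε < ‖d * x * d‖) := by
  exact exists_matrix_approximation hsimple hα (CrossedProduct.isCovariantSpan α) F hε hs hs0
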